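/- All polytopes are $3$-dimensional simplicial convex polytopes; "face" means $2$-dimensional face (a triangle), the degree of a vertex is its degree in the $1$-skeleton, and isomorphism means combinatorial isomorphism (a bijection between the vertex sets under which the boundary complexes correspond). A \emph{connected sum} of polytopes $P$ and $Q$ is a polytope whose boundary complex is obtained from the boundary complexes of $P$ and $Q$ by choosing a face of $P$ and a face of $Q$, identifying their vertices by some bijection, and deleting the common face. Let $\mathcal{C}(P\#Q)$ be the set of connected sums of $P$ and $Q$ up to isomorphism. A polytope is \emph{irreducible} if it is not a connected sum of two polytopes. The \emph{type} of a face is the triple $(x,y,z)$ of the degrees of its three vertices, with $x\ge y\ge z$. A polytope is \emph{face-transitive} if all its faces have the same type, and \emph{regular} if moreover this common type is $(x,x,x)$ for some integer $x$. \textbf{Lemma.} Let $P$ and $Q$ be irreducible polytopes with $|\mathcal{C}(P\#Q)|=1$. Then one of $P$, $Q$ is regular and the other is face-transitive. -/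

import Mathlib

/-- A `3`-dimensional simplicial polytope: the convex hull of a finite subset of `ℝ³`, with
non-empty interior, all of whose proper faces are simplices (the vertices of each proper face are
affinely independent). The faces of a polytope are its exposed subsets. -/
structure SimplicialPolytope where
  carrier : Set (EuclideanSpace ℝ (Fin 3))
  exists_finset : ∃ s : Finset (EuclideanSpace ℝ (Fin 3)),
    carrier = convexHull ℝ (s : Set (EuclideanSpace ℝ (Fin 3)))
  interior_nonempty : (interior carrier).Nonempty
  simplicial : ∀ A : Set (EuclideanSpace ℝ (Fin 3)), IsExposed ℝ carrier A → A ≠ carrier →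
    AffineIndependent ℝ
      (Subtype.val : Set.extremePoints ℝ A → EuclideanSpace ℝ (Fin 3))

namespace SimplicialPolytope

/-- The type of vertices of `P`. -/
abbrev Vertex (P : SimplicialPolytope) : Type := Set.extremePoints ℝ P.carrier

/-- The boundary complex of `P`: `σ` is the vertex set of a proper (possibly empty) face of `P`. -/
def IsFace (P : SimplicialPolytope) (σ : Set P.Vertex) : Prop :=
  IsExposed ℝ P.carrier (convexHull ℝ (Subtype.val '' σ)) ∧
    convexHull ℝ (Subtype.val '' σ) ≠ P.carrier

/-- `σ` is the vertex set of a facet (a `2`-dimensional face). Since proper faces are simplices,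
these are the proper faces with exactly three vertices. -/
def IsFacet (P : SimplicialPolytope) (σ : Set P.Vertex) : Prop :=
  P.IsFace σ ∧ σ.ncard = 3

/-- The `1`-skeleton of `P`. -/
def graph (P : SimplicialPolytope) : SimpleGraph P.Vertex where
  Adj v w := v ≠ w ∧ P.IsFace {v, w}
  symm := ⟨fun _ _ h => ⟨h.1.symm, Set.pair_comm _ _ ▸ h.2⟩⟩
  loopless := ⟨fun _ h => h.1 rfl⟩

/-- The degree of a vertex: the number of its neighbours in the `1`-skeleton. -/
noncomputable def degree (P : SimplicialPolytope) (v : P.Vertex) : ℕ :=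
  (P.graph.neighborSet v).ncard

/-- The facet with vertex set `F` has type `(x, y, z)`: its three vertices have degrees
`x ≥ y ≥ z`. -/
def FacetHasType (P : SimplicialPolytope) (F : Set P.Vertex) (x y z : ℕ) : Prop :=
  x ≥ y ∧ y ≥ z ∧ ∃ u v w : P.Vertex, u ≠ v ∧ u ≠ w ∧ v ≠ w ∧ F = {u, v, w} ∧
    P.degree u = x ∧ P.degree v = y ∧ P.degree w = z

/-- `P` has type `(x, y, z)`: all facets of `P` have type `(x, y, z)`. -/
def HasType (P : SimplicialPolytope) (x y z : ℕ) : Prop :=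
  ∀ F : Set P.Vertex, P.IsFacet F → P.FacetHasType F x y z

/-- All facets of `P` have the same type. -/
def FaceTransitive (P : SimplicialPolytope) : Prop :=
  ∃ x y z : ℕ, P.HasType x y z

/-- `P` is face-transitive of type `(x, x, x)` for some `x`. -/
def Regular (P : SimplicialPolytope) : Prop :=
  ∃ x : ℕ, P.HasType x x x

/-- Combinatorial isomorphism: a bijection of the vertices which preserves and reflects faces. -/
def Isomorphic (P Q : SimplicialPolytope) : Prop :=
  ∃ e : P.Vertex ≃ Q.Vertex, ∀ σ : Set P.Vertex, P.IsFace σ ↔ Q.IsFace (e '' σ)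

theorem Isomorphic.equivalence : Equivalence Isomorphic where
  refl P := ⟨Equiv.refl _, fun σ => by simp⟩
  symm := by
    rintro P Q ⟨e, he⟩
    refine ⟨e.symm, fun σ => ?_⟩
    rw [he, Equiv.image_symm_image]
  trans := by
    rintro P Q R ⟨e, he⟩ ⟨f, hf⟩
    refine ⟨e.trans f, fun σ => ?_⟩
    rw [he, hf, Equiv.coe_trans, Set.image_comp]

/-- Polytopes up to isomorphism. -/
def isoSetoid : Setoid SimplicialPolytope := ⟨Isomorphic, Isomorphic.equivalence⟩

/-- The polytope `R` is a connected sum of `P` and `Q`: its boundary complex is obtained from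
those of `P` and `Q` by choosing a facet `F` of `P` and a facet `G` of `Q`, identifying the
vertices of `F` with those of `G` by some bijection, and removing the facet `F = G`.
Here `i` and `j` are the inclusions of the vertices of `P` and of `Q` into the glued vertex set. -/
def IsConnectedSum (P Q R : SimplicialPolytope) : Prop :=
  ∃ (F : Set P.Vertex) (G : Set Q.Vertex) (i : P.Vertex ↪ R.Vertex) (j : Q.Vertex ↪ R.Vertex),
    P.IsFacet F ∧ Q.IsFacet G ∧
    i '' F = j '' G ∧
    Set.range i ∩ Set.range j = i '' F ∧
    Set.range i ∪ Set.range j = Set.univ ∧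
    ∀ τ : Set R.Vertex, R.IsFace τ ↔
      (∃ σ : Set P.Vertex, P.IsFace σ ∧ σ ≠ F ∧ i '' σ = τ) ∨
      (∃ σ : Set Q.Vertex, Q.IsFace σ ∧ σ ≠ G ∧ j '' σ = τ)

/-- The set of connected sums of `P` and `Q`, up to isomorphism. -/
def connectedSums (P Q : SimplicialPolytope) : Set (Quotient isoSetoid) :=
  {c | ∃ R : SimplicialPolytope, IsConnectedSum P Q R ∧ Quotient.mk isoSetoid R = c}

/-- `P` is not a connected sum of two polytopes. -/
def Irreducible (P : SimplicialPolytope) : Prop :=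
  ¬ ∃ P₁ P₂ : SimplicialPolytope, IsConnectedSum P₁ P₂ P

end SimplicialPolytope

/-! Glue `P` and `Q` along labelled facets `a`, `b`. In the sum, a vertex of the common triangle has
degree `P.degree (a k) + Q.degree (b k) - 2`. The common triangle is recognizable: its edges survive
but it is no longer a face, and when `P` and `Q` are irreducible no other triangle has this
property. As all sums are isomorphic, the multiset of the three numbers `P.degree (a k) + Q.degree
(b k)` depends neither on the facets nor on the labelling (`exists_perm_degree_add_eq`).

For fixed facets, equality of the sums of squares over all relabellings makes the scalar product of
the two degree triples invariant under permutations, so one triple is constant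
(`forall_eq_or_forall_eq_of_perm`). Hence one polytope, say `P`, has constant degrees on each facet.
Varying the facet of `P` gives regularity of `P`; varying that of `Q` gives face-transitivity of `Q`
(`regular_and_faceTransitive`).

Two geometric facts support this: any two facets can be glued with any identification
(`exists_isSumAlong`), and a missing triangle makes a polytope reducible
(`exists_isConnectedSum_of_missing_triangle`). Both are proved for cones in a four-dimensional
space, where projective transformations become linear maps with rescaling. Coordinates are chosen so
that the triangle is spanned by three coordinate vectors, all other vertices have positive first
three coordinates, and the sign of the last coordinate separates the two halves. Cutting and gluing
are then inverse operations. -/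

/-! ### Faces of simplicial cones. -/

/-- `σ` is a proper face of the cone generated by the vectors `p i`: some linear functional is
nonnegative on all of them and vanishes exactly on those with index in `σ`. -/
def IsConeFace {ι V : Type*} [AddCommGroup V] [Module ℝ V] (p : ι → V) (σ : Set ι) : Prop :=
  σ ≠ Set.univ ∧ ∃ ℓ : Module.Dual ℝ V, (∀ i, 0 ≤ ℓ (p i)) ∧ ∀ i, ℓ (p i) = 0 ↔ i ∈ σ

/-- The vectors `p i` span the extreme rays of a full-dimensional pointed cone, all of whose proper
faces are simplicial. -/
structure IsSimplicialConfig {ι V : Type*} [AddCommGroup V] [Module ℝ V] (p : ι → V) : Prop where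
  spanning : ∀ ℓ : Module.Dual ℝ V, (∀ i, ℓ (p i) = 0) → ℓ = 0
  empty : IsConeFace p ∅
  vertex : ∀ i, IsConeFace p {i}
  simplicial : ∀ σ, IsConeFace p σ → LinearIndependent ℝ (fun i : σ => p i)

section Config

variable {ι V V' : Type*} [AddCommGroup V] [Module ℝ V] [AddCommGroup V'] [Module ℝ V']

/-- Faces depend only on the rays, up to linear isomorphism; for polytopes this is invariance under
admissible projective transformations. -/
theorem isConeFace_smul_equiv (A : V ≃ₗ[ℝ] V') (c : ι → ℝ) (hc : ∀ i, 0 < c i) (p : ι → V)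
    (σ : Set ι) : IsConeFace (fun i => c i • A (p i)) σ ↔ IsConeFace p σ := by
  refine and_congr_right fun _ => ⟨?_, ?_⟩
  · rintro ⟨ℓ, h0, h1⟩
    refine ⟨ℓ ∘ₗ A.toLinearMap, fun i => ?_, fun i => ?_⟩
    · have := h0 i
      rw [map_smul, smul_eq_mul] at this
      exact (mul_nonneg_iff_of_pos_left (hc i)).1 this
    · rw [← h1 i, map_smul, smul_eq_mul, mul_eq_zero, or_iff_right (hc i).ne']
      rfl
  · rintro ⟨ℓ, h0, h1⟩
    refine ⟨ℓ ∘ₗ A.symm.toLinearMap, fun i => ?_, fun i => ?_⟩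
    · simpa using mul_nonneg (hc i).le (h0 i)
    · simp [(hc i).ne', h1 i]

theorem isConeFace_equiv (A : V ≃ₗ[ℝ] V') (p : ι → V) (σ : Set ι) :
    IsConeFace (fun i => A (p i)) σ ↔ IsConeFace p σ := by
  simpa using isConeFace_smul_equiv A (fun _ => 1) (fun _ => one_pos) p σ

theorem IsSimplicialConfig.smul_equiv {p : ι → V} (hp : IsSimplicialConfig p) (A : V ≃ₗ[ℝ] V')
    (c : ι → ℝ) (hc : ∀ i, 0 < c i) : IsSimplicialConfig (fun i => c i • A (p i)) where
  spanning ℓ h := by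
    have : ℓ ∘ₗ A.toLinearMap = 0 := hp.spanning _ fun i => by
      have := h i
      rw [map_smul, smul_eq_mul, mul_eq_zero, or_iff_right (hc i).ne'] at this
      exact this
    ext v
    simpa using LinearMap.congr_fun this (A.symm v)
  empty := (isConeFace_smul_equiv A c hc p _).2 hp.empty
  vertex i := (isConeFace_smul_equiv A c hc p _).2 (hp.vertex i)
  simplicial σ h := by
    have h1 := hp.simplicial σ ((isConeFace_smul_equiv A c hc p _).1 h)
    have h2 := (h1.map' A.toLinearMap A.ker).units_smul (fun i => Units.mk0 (c i) (hc i).ne')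
    exact h2

theorem IsSimplicialConfig.equiv {p : ι → V} (hp : IsSimplicialConfig p) (A : V ≃ₗ[ℝ] V') :
    IsSimplicialConfig (fun i => A (p i)) := by
  simpa using hp.smul_equiv A (fun _ => 1) (fun _ => one_pos)

theorem IsSimplicialConfig.injective {p : ι → V} (hp : IsSimplicialConfig p) :
    Function.Injective p := by
  intro i j hij
  obtain ⟨-, ℓ, -, h⟩ := hp.vertex i
  have : j ∈ ({i} : Set ι) := (h j).1 (hij ▸ (h i).2 rfl)
  exact this.symm

theorem LinearIndependent.exists_dual_eq {p : ι → V} (hp : LinearIndependent ℝ p) (g : ι → ℝ) :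
    ∃ m : Module.Dual ℝ V, ∀ i, m (p i) = g i := by
  obtain ⟨m, hm⟩ := LinearMap.exists_extend ((Module.Basis.span hp).constr ℝ g)
  refine ⟨m, fun i => ?_⟩
  have h1 := LinearMap.congr_fun hm (Module.Basis.span hp i)
  rw [Module.Basis.constr_basis] at h1
  rw [← h1, LinearMap.comp_apply, Submodule.subtype_apply, Module.Basis.span_apply]

/-- With `g` a functional supporting a face `σ`, this makes any other functional positive off `σ`
without changing it on `σ`. -/
theorem exists_pos_add_mul [Finite ι] (σ : Set ι) (f g : ι → ℝ) (hg : ∀ i, i ∉ σ → 0 < g i) :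
    ∃ N : ℝ, ∀ i, i ∉ σ → 0 < f i + N * g i := by
  obtain ⟨N, hN⟩ := (Set.finite_range fun i => (1 - f i) / g i).bddAbove
  refine ⟨N, fun i hi => ?_⟩
  have h1 : (1 - f i) / g i ≤ N := hN ⟨i, rfl⟩
  have := (div_le_iff₀ (hg i hi)).1 h1
  linarith

theorem IsConeFace.pos {p : ι → V} {σ : Set ι} {ℓ : Module.Dual ℝ V} (h0 : ∀ i, 0 ≤ ℓ (p i))
    (h1 : ∀ i, ℓ (p i) = 0 ↔ i ∈ σ) {i : ι} (hi : i ∉ σ) : 0 < ℓ (p i) :=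
  (h0 i).lt_of_ne' fun h => hi ((h1 i).1 h)

/-- Linear independence allows the values 0 on `τ` and 1 on the rest of `σ` to be prescribed; a
large multiple of the functional supporting `σ` then gives positivity elsewhere. -/
theorem IsSimplicialConfig.mono [Finite ι] {p : ι → V} (hp : IsSimplicialConfig p) {σ τ : Set ι}
    (h : IsConeFace p σ) (hτ : τ ⊆ σ) : IsConeFace p τ := by
  classical
  obtain ⟨m, hm⟩ := (hp.simplicial σ h).exists_dual_eq (fun i => if (i : ι) ∈ τ then 0 else 1)
  obtain ⟨hu, ℓ, h0, h1⟩ := h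
  obtain ⟨N, hN⟩ := exists_pos_add_mul σ (fun i => m (p i)) (fun i => ℓ (p i))
    fun i hi => IsConeFace.pos h0 h1 hi
  have key : ∀ i, (i ∈ τ ∧ (m + N • ℓ) (p i) = 0) ∨ (i ∉ τ ∧ 0 < (m + N • ℓ) (p i)) := by
    intro i
    by_cases hi : i ∈ σ
    · have := hm ⟨i, hi⟩
      by_cases hi' : i ∈ τ <;> simp [hi', this, (h1 i).2 hi]
    · exact Or.inr ⟨fun h => hi (hτ h), by simpa using hN i hi⟩
  refine ⟨fun h => hu (Set.eq_univ_of_univ_subset (h ▸ hτ)), m + N • ℓ, fun i => ?_, fun i => ?_⟩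
  · rcases key i with h | h
    · exact h.2.ge
    · exact h.2.le
  · rcases key i with h | h
    · exact iff_of_true h.2 h.1
    · exact iff_of_false h.2.ne' h.1

theorem IsSimplicialConfig.linearIndependent_comp {p : ι → V} (hp : IsSimplicialConfig p)
    {κ : Type*} {a : κ → ι} (ha : Function.Injective a) (h : IsConeFace p (Set.range a)) :
    LinearIndependent ℝ (p ∘ a) :=
  (hp.simplicial _ h).comp (fun k => (⟨a k, k, rfl⟩ : Set.range a))
    fun _ _ hkl => ha (congrArg Subtype.val hkl)

end Config

/-! ### Homogenization: from polytopes to cones. -/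

/-- An affine function which is nonnegative on `s` vanishes, on the convex hull of `s`, only in the
convex hull of its zeros in `s`. -/
theorem convexHull_zeros_of_nonneg {E : Type*} [AddCommGroup E] [Module ℝ E]
    (ℓ : Module.Dual ℝ (E × ℝ)) (s : Set E) (hs : ∀ x ∈ s, 0 ≤ ℓ (x, 1)) :
    ∀ x ∈ convexHull ℝ s, 0 ≤ ℓ (x, 1) ∧
      (ℓ (x, 1) = 0 → x ∈ convexHull ℝ {y ∈ s | ℓ (y, 1) = 0}) := by
  apply convexHull_min
    (t := {x | 0 ≤ ℓ (x, 1) ∧ (ℓ (x, 1) = 0 → x ∈ convexHull ℝ {y ∈ s | ℓ (y, 1) = 0})})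
  · exact fun x hx => ⟨hs x hx, fun h => subset_convexHull ℝ _ ⟨hx, h⟩⟩
  · rintro x ⟨hx0, hx1⟩ y ⟨hy0, hy1⟩ a b ha hb hab
    have key : ℓ (a • x + b • y, 1) = a * ℓ (x, 1) + b * ℓ (y, 1) := by
      rw [← smul_eq_mul, ← smul_eq_mul, ← map_smul, ← map_smul, ← map_add]
      simp [hab]
    refine ⟨key ▸ by positivity, fun h => ?_⟩
    rw [key] at h
    have h1 : a * ℓ (x, 1) = 0 := by nlinarith [mul_nonneg ha hx0, mul_nonneg hb hy0]
    have h2 : b * ℓ (y, 1) = 0 := by nlinarith [mul_nonneg ha hx0, mul_nonneg hb hy0]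
    rcases mul_eq_zero.1 h1 with h1 | h1
    · subst h1
      obtain rfl : b = 1 := by linarith
      simpa using hy1 (by simpa using h2)
    rcases mul_eq_zero.1 h2 with h2 | h2
    · subst h2
      obtain rfl : a = 1 := by linarith
      simpa using hx1 (by simpa using h1)
    · exact convex_convexHull ℝ _ (hx1 h1) (hy1 h2) ha hb hab

/-- The linear functional on `E × ℝ` whose value at `(x, 1)` is `c - f x`. -/
def slackDual {E : Type*} [AddCommGroup E] [Module ℝ E] (f : E →ₗ[ℝ] ℝ) (c : ℝ) :
    Module.Dual ℝ (E × ℝ) := c • LinearMap.snd ℝ E ℝ - f ∘ₗ LinearMap.fst ℝ E ℝ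

@[simp] theorem slackDual_apply {E : Type*} [AddCommGroup E] [Module ℝ E] (f : E →ₗ[ℝ] ℝ) (c : ℝ)
    (x : E) : slackDual f c (x, 1) = c - f x := by
  simp [slackDual]

theorem dual_prod_apply {E : Type*} [AddCommGroup E] [Module ℝ E] (ℓ : Module.Dual ℝ (E × ℝ))
    (x : E) : ℓ (x, 1) = ℓ (x, 0) + ℓ (0, 1) := by
  rw [← map_add]; simp

theorem affineSpan_eq_top_iff_dual {E : Type*} [AddCommGroup E] [Module ℝ E] {s : Set E}
    (hs : s.Nonempty) : affineSpan ℝ s = ⊤ ↔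
      ∀ ℓ : Module.Dual ℝ (E × ℝ), (∀ x ∈ s, ℓ (x, 1) = 0) → ℓ = 0 := by
  constructor
  · intro h ℓ hℓ
    have hv : vectorSpan ℝ s ≤ LinearMap.ker (ℓ ∘ₗ LinearMap.inl ℝ E ℝ) := by
      refine Submodule.span_le.2 ?_
      rintro _ ⟨x, hx, y, hy, rfl⟩
      have h1 := hℓ x hx
      have h2 := hℓ y hy
      rw [dual_prod_apply] at h1 h2
      have : ℓ (x, 0) - ℓ (y, 0) = 0 := by linarith
      rw [← map_sub] at this
      simpa using this
    rw [← direction_affineSpan, h, AffineSubspace.direction_top] at hv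
    have h0 : ∀ x, ℓ (x, 0) = 0 := fun x => hv (Submodule.mem_top (x := x))
    obtain ⟨x, hx⟩ := hs
    have h1 := hℓ x hx
    rw [dual_prod_apply, h0, zero_add] at h1
    ext x
    · simpa using h0 x
    · simpa using h1
  · intro h
    rw [AffineSubspace.affineSpan_eq_top_iff_vectorSpan_eq_top_of_nonempty ℝ E E hs]
    by_contra hne
    obtain ⟨f, hf0, hf⟩ := Submodule.exists_le_ker_of_lt_top _ (lt_top_iff_ne_top.2 hne)
    obtain ⟨x, hx⟩ := hs
    have h1 := h (slackDual f (f x)) fun y hy => by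
      have : f (x - y) = 0 := hf (vsub_mem_vectorSpan ℝ hx hy)
      rw [slackDual_apply, ← map_sub, this]
    apply hf0
    ext y
    have h2 := LinearMap.congr_fun h1 (y, 0)
    simpa [slackDual] using h2

theorem linearIndependent_prod_one_iff {ι E : Type*} [AddCommGroup E] [Module ℝ E] (x : ι → E) :
    LinearIndependent ℝ (fun i => (x i, (1 : ℝ))) ↔ AffineIndependent ℝ x := by
  rw [linearIndependent_iff', affineIndependent_iff]
  refine forall_congr' fun s => forall_congr' fun w => ?_
  have : ∑ i ∈ s, w i • (x i, (1 : ℝ)) = (∑ i ∈ s, w i • x i, ∑ i ∈ s, w i) := by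
    ext <;> simp [Prod.fst_sum, Prod.snd_sum]
  rw [this, Prod.mk_eq_zero]
  tauto

namespace SimplicialPolytope

variable (P : SimplicialPolytope)

/-- The vertices of `P` in homogeneous coordinates. -/
def lift (v : P.Vertex) : EuclideanSpace ℝ (Fin 3) × ℝ := (v, 1)

theorem isCompact_carrier : IsCompact P.carrier := by
  obtain ⟨s, hs⟩ := P.exists_finset
  exact hs ▸ s.finite_toSet.isCompact_convexHull ℝ

theorem convex_carrier : Convex ℝ P.carrier := by
  obtain ⟨s, hs⟩ := P.exists_finset
  exact hs ▸ convex_convexHull ℝ _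

theorem finite_extremePoints : (Set.extremePoints ℝ P.carrier).Finite := by
  obtain ⟨s, hs⟩ := P.exists_finset
  exact s.finite_toSet.subset (hs ▸ extremePoints_convexHull_subset)

instance : Finite P.Vertex := P.finite_extremePoints

theorem convexHull_extremePoints : convexHull ℝ (Set.extremePoints ℝ P.carrier) = P.carrier := by
  rw [← (P.finite_extremePoints.isCompact_convexHull ℝ).isClosed.closure_eq]
  exact closure_convexHull_extremePoints P.isCompact_carrier P.convex_carrier

theorem extremePoints_nonempty : (Set.extremePoints ℝ P.carrier).Nonempty := by
  rw [← convexHull_nonempty_iff (𝕜 := ℝ), convexHull_extremePoints]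
  exact P.interior_nonempty.mono interior_subset

theorem convexHull_subset_carrier (σ : Set P.Vertex) :
    convexHull ℝ (Subtype.val '' σ) ⊆ P.carrier :=
  convexHull_min (by rintro _ ⟨v, -, rfl⟩; exact v.2.1) P.convex_carrier

theorem mem_convexHull_image_iff (σ : Set P.Vertex) (v : P.Vertex) :
    (v : EuclideanSpace ℝ (Fin 3)) ∈ convexHull ℝ (Subtype.val '' σ) ↔ v ∈ σ := by
  refine ⟨fun h => ?_, fun h => subset_convexHull ℝ _ ⟨v, h, rfl⟩⟩
  obtain ⟨w, hw, hwv⟩ := extremePoints_convexHull_subset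
    (inter_extremePoints_subset_extremePoints_of_subset (P.convexHull_subset_carrier σ) ⟨h, v.2⟩)
  rwa [← Subtype.ext hwv]

/-- A functional maximal on the face, with maximum `c`, corresponds to its slack `c - l x`, made
linear by the extra coordinate. -/
theorem isFace_iff (σ : Set P.Vertex) : P.IsFace σ ↔ IsConeFace P.lift σ := by
  constructor
  · rintro ⟨h1, h2⟩
    refine ⟨?_, ?_⟩
    · rintro rfl
      rw [Set.image_univ, Subtype.range_coe, convexHull_extremePoints] at h2
      exact h2 rfl
    rcases σ.eq_empty_or_nonempty with rfl | ⟨s, hs⟩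
    -- `IsExposed` says nothing about the empty set; the last coordinate, equal to 1 on all lifted
    -- vertices, exposes the empty face.
    · exact ⟨LinearMap.snd ℝ _ _, fun i => by simp [lift], fun i => by simp [lift]⟩
    obtain ⟨l, hl⟩ := h1 ⟨s, (P.mem_convexHull_image_iff σ s).2 hs⟩
    have hs' := (P.mem_convexHull_image_iff σ s).2 hs
    rw [hl] at hs'
    have hle : ∀ v : P.Vertex, l v ≤ l s := fun v => hs'.2 v v.2.1
    refine ⟨slackDual l (l s), fun v => ?_, fun v => ?_⟩
    · simpa [lift] using hle v
    · rw [← P.mem_convexHull_image_iff σ v, hl]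
      simp only [lift, slackDual_apply, sub_eq_zero]
      exact ⟨fun h => ⟨v.2.1, fun y hy => h ▸ hs'.2 y hy⟩, fun h => le_antisymm (h.2 s s.2.1) (hle v)⟩
  · rintro ⟨hu, ℓ, h0, h1⟩
    have hC := convexHull_zeros_of_nonneg ℓ (Set.extremePoints ℝ P.carrier)
      fun x hx => h0 ⟨x, hx⟩
    rw [convexHull_extremePoints] at hC
    have hZ : {y ∈ Set.extremePoints ℝ P.carrier | ℓ (y, 1) = 0} = Subtype.val '' σ := by
      ext y
      constructor
      · rintro ⟨hy, h⟩
        exact ⟨⟨y, hy⟩, (h1 ⟨y, hy⟩).1 h, rfl⟩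
      · rintro ⟨v, hv, rfl⟩
        exact ⟨v.2, (h1 v).2 hv⟩
    rw [hZ] at hC
    refine ⟨?_, ?_⟩
    · rintro ⟨x₀, hx₀⟩
      have hz : ∀ x ∈ convexHull ℝ (Subtype.val '' σ), ℓ (x, 1) = 0 := by
        apply convexHull_min (t := {x | ℓ (x, 1) = 0})
        · rintro _ ⟨v, hv, rfl⟩
          exact (h1 v).2 hv
        · intro x hx y hy a b ha hb hab
          have : (a • x + b • y, (1 : ℝ)) = a • (x, (1 : ℝ)) + b • (y, (1 : ℝ)) := by simp [hab]
          change ℓ _ = 0 at hx hy ⊢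
          rw [this, map_add, map_smul, map_smul, hx, hy]
          simp
      refine ⟨LinearMap.toContinuousLinearMap (-(ℓ ∘ₗ LinearMap.inl ℝ _ ℝ)), ?_⟩
      ext x
      simp only [LinearMap.coe_toContinuousLinearMap', LinearMap.neg_apply, LinearMap.comp_apply,
        LinearMap.inl_apply, neg_le_neg_iff, Set.mem_ofPred_eq]
      constructor
      · intro hx
        refine ⟨P.convexHull_subset_carrier σ hx, fun y hy => ?_⟩
        have h2 := (hC y hy).1
        have h3 := hz x hx
        rw [dual_prod_apply] at h2 h3
        linarith
      · rintro ⟨hx, hy⟩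
        have h2 := hy x₀ (P.convexHull_subset_carrier σ hx₀)
        have h3 := hz x₀ hx₀
        have h4 := (hC x hx).1
        refine (hC x hx).2 ?_
        rw [dual_prod_apply] at h3 h4 ⊢
        linarith
    · intro h
      refine hu (Set.eq_univ_of_forall fun v => ?_)
      rw [← P.mem_convexHull_image_iff σ v, h]
      exact v.2.1

theorem spanning_lift (ℓ : Module.Dual ℝ (EuclideanSpace ℝ (Fin 3) × ℝ))
    (h : ∀ v, ℓ (P.lift v) = 0) : ℓ = 0 := by
  have := P.interior_nonempty
  rw [← P.convexHull_extremePoints, interior_convexHull_nonempty_iff_affineSpan_eq_top,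
    affineSpan_eq_top_iff_dual P.extremePoints_nonempty] at this
  exact this ℓ fun x hx => h ⟨x, hx⟩

theorem isSimplicialConfig_lift : IsSimplicialConfig P.lift where
  spanning := P.spanning_lift
  empty := by
    obtain ⟨x, hx⟩ := P.extremePoints_nonempty
    exact ⟨fun h => (h ▸ Set.mem_univ (⟨x, hx⟩ : P.Vertex) : (⟨x, hx⟩ : P.Vertex) ∈ (∅ : Set _)),
      LinearMap.snd ℝ _ _, fun i => by simp [lift], fun i => by simp [lift]⟩
  vertex v := by
    have hclosed : IsClosed (convexHull ℝ (Subtype.val '' ({v}ᶜ : Set P.Vertex))) :=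
      ((Set.toFinite _).isCompact_convexHull ℝ).isClosed
    have hv : (v : EuclideanSpace ℝ (Fin 3)) ∉ convexHull ℝ (Subtype.val '' ({v}ᶜ : Set P.Vertex)) :=
      fun h => (P.mem_convexHull_image_iff _ v).1 h rfl
    -- An extreme point lies outside the hull of the other vertices, and a separating functional
    -- exposes it.
    obtain ⟨f, u, hf, hfu⟩ := geometric_hahn_banach_point_closed (convex_convexHull ℝ _) hclosed hv
    have hlt : ∀ w, w ≠ v → f v < f w := fun w hw =>
      hf.trans (hfu w ((P.mem_convexHull_image_iff _ w).2 hw))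
    refine ⟨fun h => ?_, -slackDual f (f v), fun w => ?_, fun w => ?_⟩
    · obtain ⟨g, hg⟩ : ∃ g : EuclideanSpace ℝ (Fin 3) →ₗ[ℝ] ℝ, g ≠ 0 := exists_ne 0
      have h1 := P.spanning_lift (slackDual g (g v)) fun w => by
        have : w ∈ ({v} : Set P.Vertex) := h ▸ Set.mem_univ w
        obtain rfl : w = v := this
        simp [lift]
      apply hg
      ext y
      simpa [slackDual] using LinearMap.congr_fun h1 (y, 0)
    · by_cases hw : w = v
      · simp [lift, hw]
      · simpa [lift] using (hlt w hw).le
    · by_cases hw : w = v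
      · simp [lift, hw]
      · simpa [lift, hw, sub_eq_zero] using (hlt w hw).ne'
  simplicial σ h := by
    obtain ⟨h1, h2⟩ := (P.isFace_iff σ).2 h
    have h3 := P.simplicial _ h1 h2
    have h4 : LinearIndependent ℝ fun i : Set.extremePoints ℝ (convexHull ℝ (Subtype.val '' σ)) =>
      ((i : EuclideanSpace ℝ (Fin 3)), (1 : ℝ)) := (linearIndependent_prod_one_iff _).2 h3
    refine h4.comp (fun i : σ => ⟨i, inter_extremePoints_subset_extremePoints_of_subset
      (P.convexHull_subset_carrier σ) ⟨(P.mem_convexHull_image_iff σ i).2 i.2, i.1.2⟩⟩) ?_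
    intro i j hij
    exact Subtype.ext (Subtype.ext (Subtype.mk.inj hij))

end SimplicialPolytope

/-! ### Realizing cones by polytopes. -/

namespace SimplicialPolytope

theorem exists_vertex_equiv_of_affine {ι : Type*} [Finite ι] (x : ι → EuclideanSpace ℝ (Fin 3))
    (hx : IsSimplicialConfig fun i => (x i, (1 : ℝ))) :
    ∃ (P : SimplicialPolytope) (e : ι ≃ P.Vertex), ∀ i, (e i : EuclideanSpace ℝ (Fin 3)) = x i := by
  have hinj : Function.Injective x := fun i j h => hx.injective (Prod.ext h rfl)
  have hne : (Set.range x).Nonempty := by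
    by_contra h
    rw [Set.range_nonempty_iff_nonempty, not_nonempty_iff] at h
    exact hx.empty.1 (Set.eq_univ_of_forall fun i => h.elim i)
  have hext : Set.extremePoints ℝ (convexHull ℝ (Set.range x)) = Set.range x := by
    refine subset_antisymm extremePoints_convexHull_subset ?_
    rintro _ ⟨i, rfl⟩
    obtain ⟨-, ℓ, h0, h1⟩ := hx.vertex i
    have hC := convexHull_zeros_of_nonneg ℓ (Set.range x) (by rintro _ ⟨j, rfl⟩; exact h0 j)
    have hZ : {y ∈ Set.range x | ℓ (y, 1) = 0} = {x i} := by
      ext y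
      constructor
      · rintro ⟨⟨j, rfl⟩, h⟩
        rw [(h1 j).1 h]; rfl
      · rintro rfl
        exact ⟨⟨i, rfl⟩, (h1 i).2 rfl⟩
    have hi := (h1 i).2 rfl
    simp only [hZ, convexHull_singleton, Set.mem_singleton_iff] at hC
    refine exposedPoints_subset_extremePoints ⟨subset_convexHull ℝ _ ⟨i, rfl⟩,
      LinearMap.toContinuousLinearMap (-(ℓ ∘ₗ LinearMap.inl ℝ _ ℝ)), fun y hy => ?_⟩
    have hy := hC y hy
    have hi' := dual_prod_apply ℓ (x i)
    have hy' := dual_prod_apply ℓ y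
    simp only [LinearMap.coe_toContinuousLinearMap', LinearMap.neg_apply, LinearMap.comp_apply,
      LinearMap.inl_apply]
    exact ⟨by linarith, fun h => hy.2 (by linarith)⟩
  let P : SimplicialPolytope :=
    { carrier := convexHull ℝ (Set.range x)
      exists_finset := ⟨(Set.finite_range x).toFinset, by simp⟩
      interior_nonempty := by
        rw [interior_convexHull_nonempty_iff_affineSpan_eq_top, affineSpan_eq_top_iff_dual hne]
        exact fun ℓ hℓ => hx.spanning ℓ fun i => hℓ _ ⟨i, rfl⟩
      simplicial := by
        intro A hA hAC
        rcases A.eq_empty_or_nonempty with rfl | ⟨y, hy⟩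
        · have : IsEmpty (Set.extremePoints ℝ (∅ : Set (EuclideanSpace ℝ (Fin 3)))) := by simp
          exact affineIndependent_of_subsingleton ℝ _
        have hsub := hA.isExtreme.extremePoints_subset_extremePoints
        rw [hext] at hsub
        obtain ⟨l, hl⟩ := hA ⟨y, hy⟩
        have hmem : ∀ i, x i ∈ convexHull ℝ (Set.range x) :=
          fun i => subset_convexHull ℝ _ ⟨i, rfl⟩
        have hy' := hy
        rw [hl] at hy'
        have hA' : ∀ i, slackDual l (l y) (x i, 1) = 0 ↔ i ∈ {i | x i ∈ A} := by
          intro i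
          rw [Set.mem_ofPred_eq, hl, slackDual_apply, sub_eq_zero]
          exact ⟨fun h => ⟨hmem i, fun z hz => (hy'.2 z hz).trans_eq h⟩,
            fun h => le_antisymm (h.2 y hy'.1) (hy'.2 _ (hmem i))⟩
        have hface : IsConeFace (fun i => (x i, (1 : ℝ))) {i | x i ∈ A} := by
          refine ⟨fun h => hAC ?_, slackDual l (l y), fun i => ?_, hA'⟩
          · refine hA.subset.antisymm (convexHull_min ?_ (hA.convex (convex_convexHull ℝ _)))
            rintro _ ⟨i, rfl⟩
            exact (h ▸ Set.mem_univ i : i ∈ {i | x i ∈ A})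
          · simpa using hy'.2 _ (hmem i)
        rw [← linearIndependent_prod_one_iff]
        choose g hg using fun v : Set.extremePoints ℝ A => hsub v.2
        have hcomp : (fun v : Set.extremePoints ℝ A => ((v : EuclideanSpace ℝ (Fin 3)), (1 : ℝ))) =
            fun v => (x (g v), 1) := funext fun v => by rw [hg]
        rw [hcomp]
        exact (hx.simplicial _ hface).comp
          (fun v : Set.extremePoints ℝ A => ⟨g v, show x (g v) ∈ A from hg v ▸ v.2.1⟩)
          (fun v w hvw => Subtype.ext (by rw [← hg v, ← hg w, Subtype.mk.inj hvw])) }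
  refine ⟨P, (Equiv.ofInjective x hinj).trans (Equiv.setCongr hext.symm), fun i => rfl⟩

/-- Every simplicial configuration of vectors in a four-dimensional space comes from a polytope. -/
theorem exists_realization {ι V : Type*} [Finite ι] [AddCommGroup V] [Module ℝ V]
    (hV : Module.finrank ℝ V = 4) {p : ι → V} (hp : IsSimplicialConfig p) :
    ∃ (P : SimplicialPolytope) (e : ι ≃ P.Vertex), ∀ σ, P.IsFace (e '' σ) ↔ IsConeFace p σ := by
  have : FiniteDimensional ℝ V := FiniteDimensional.of_finrank_pos (by omega)
  -- The functional exposing the empty face is positive on all generators, so the cone can be cut by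
  -- the affine hyperplane `ω = 1`.
  obtain ⟨hu, ω, h0, h1⟩ := hp.empty
  have hω : ∀ i, 0 < ω (p i) := fun i => IsConeFace.pos h0 h1 (Set.notMem_empty i)
  have hω0 : ω ≠ 0 := by
    rintro rfl
    exact hu (Set.eq_univ_of_forall fun i => (h1 i).1 rfl)
  have hker := Module.Dual.finrank_ker_add_one_of_ne_zero hω0
  let g : LinearMap.ker ω ≃ₗ[ℝ] EuclideanSpace ℝ (Fin 3) :=
    LinearEquiv.ofFinrankEq _ _ (by rw [finrank_euclideanSpace_fin]; omega)
  obtain ⟨f, hf⟩ := (LinearMap.ker ω).subtype.exists_leftInverse_of_injective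
    (Submodule.ker_subtype _)
  -- A projection onto the kernel of `ω`, together with `ω` as homogenizing coordinate.
  let A₀ : V →ₗ[ℝ] EuclideanSpace ℝ (Fin 3) × ℝ := (g.toLinearMap ∘ₗ f).prod ω
  have hA₀ : Function.Injective A₀ := by
    rw [← LinearMap.ker_eq_bot, LinearMap.ker_eq_bot']
    intro v hv
    have hv1 : g (f v) = 0 := congrArg Prod.fst hv
    have hv2 : ω v = 0 := congrArg Prod.snd hv
    have hv3 := LinearMap.congr_fun hf ⟨v, hv2⟩
    rw [LinearMap.comp_apply, Submodule.subtype_apply, LinearMap.id_apply,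
      (map_eq_zero_iff g g.injective).1 hv1] at hv3
    exact (congrArg Subtype.val hv3).symm
  let A := LinearMap.linearEquivOfInjective A₀ hA₀ (by
    rw [hV, Module.finrank_prod, finrank_euclideanSpace_fin, Module.finrank_self])
  have hc : ∀ i, 0 < (ω (p i))⁻¹ := fun i => inv_pos.2 (hω i)
  have hfun : (fun i => (ω (p i))⁻¹ • A (p i)) = fun i => ((ω (p i))⁻¹ • (A (p i)).1, (1 : ℝ)) := by
    funext i
    refine Prod.ext rfl ?_
    change (ω (p i))⁻¹ * ω (p i) = 1
    exact inv_mul_cancel₀ (hω i).ne'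
  have h2 := hp.smul_equiv A _ hc
  rw [hfun] at h2
  obtain ⟨P, e, he⟩ := exists_vertex_equiv_of_affine _ h2
  refine ⟨P, e, fun σ => ?_⟩
  rw [isFace_iff, ← isConeFace_smul_equiv A _ hc p σ, hfun]
  have he' : P.lift ∘ e = fun i => ((ω (p i))⁻¹ • (A (p i)).1, (1 : ℝ)) :=
    funext fun i => Prod.ext (he i) rfl
  rw [← he']
  refine and_congr ?_ (exists_congr fun ℓ => and_congr ?_ ?_)
  · rw [Ne, Ne, not_iff_not, ← Set.image_univ_of_surjective e.surjective, e.injective.image_injective.eq_iff]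
  · exact ⟨fun h i => h (e i), fun h v => by simpa using h (e.symm v)⟩
  · constructor
    · exact fun h i => (h (e i)).trans e.injective.mem_set_image
    · intro h v
      obtain ⟨i, rfl⟩ := e.surjective v
      exact (h i).trans e.injective.mem_set_image.symm

end SimplicialPolytope

/-! ### Faces of a configuration cut by the hyperplane of a triangle. -/

/-- `r` is a configuration whose vectors `r (t k)` are the first three coordinate vectors, all
others having positive first three coordinates and non-zero last coordinate. -/
structure IsGluing {κ : Type*} (r : κ → (Fin 3 → ℝ) × ℝ) (t : Fin 3 → κ) : Prop where
  base : ∀ k, r (t k) = (Pi.single k 1, 0)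
  pos : ∀ v, v ∉ Set.range t → ∀ k, 0 < (r v).1 k
  ne_zero : ∀ v, v ∉ Set.range t → (r v).2 ≠ 0

theorem dual_pi_prod_apply (ℓ : Module.Dual ℝ ((Fin 3 → ℝ) × ℝ)) (w : (Fin 3 → ℝ) × ℝ) :
    ℓ w = ∑ k, w.1 k * ℓ (Pi.single k 1, 0) + w.2 * ℓ (0, 1) := by
  have h : w = ∑ k, w.1 k • ((Pi.single k 1, 0) : (Fin 3 → ℝ) × ℝ) + w.2 • (0, 1) := by
    refine Prod.ext ?_ ?_
    · ext k
      simp [Prod.fst_sum, Finset.sum_apply, Pi.single_apply]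
    · simp [Prod.snd_sum]
  conv_lhs => rw [h]
  simp only [map_add, map_sum, map_smul, smul_eq_mul]

/-- The reflection changing the sign of the last coordinate. -/
def reflectLast : ((Fin 3 → ℝ) × ℝ) ≃ₗ[ℝ] (Fin 3 → ℝ) × ℝ :=
  (LinearEquiv.refl ℝ _).prodCongr (LinearEquiv.neg ℝ)

@[simp] theorem reflectLast_apply (w : (Fin 3 → ℝ) × ℝ) : reflectLast w = (w.1, -w.2) := rfl

namespace IsGluing

variable {κ ι : Type*} {r : κ → (Fin 3 → ℝ) × ℝ} {t : Fin 3 → κ}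

theorem reflect (hr : IsGluing r t) : IsGluing (fun v => reflectLast (r v)) t where
  base k := by simp [hr.base]
  pos v hv k := by simpa using hr.pos v hv k
  ne_zero v hv := by simpa using hr.ne_zero v hv

theorem injective (hr : IsGluing r t) : Function.Injective t := by
  intro k l hkl
  have h := congrArg (fun w => w.1 l) ((hr.base k).symm.trans (hkl ▸ hr.base l))
  by_contra hne
  simp [Ne.symm hne] at h

theorem snd_eq_zero_iff (hr : IsGluing r t) (v : κ) : (r v).2 = 0 ↔ v ∈ Set.range t := by
  refine ⟨fun h => by_contra fun hv => hr.ne_zero v hv h, ?_⟩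
  rintro ⟨k, rfl⟩
  simp [hr.base]

theorem base_nonneg (hr : IsGluing r t) {ℓ : Module.Dual ℝ ((Fin 3 → ℝ) × ℝ)} {i : ι → κ}
    (hi : Set.range i = {v | 0 ≤ (r v).2}) (h : ∀ v, 0 ≤ ℓ (r (i v))) (k : Fin 3) :
    0 ≤ ℓ (Pi.single k 1, 0) := by
  obtain ⟨v, hv⟩ : t k ∈ Set.range i := by simp [hi, hr.base]
  rw [← hr.base, ← hv]
  exact h v

theorem sum_nonneg {ℓ : Module.Dual ℝ ((Fin 3 → ℝ) × ℝ)} (hc : ∀ k, 0 ≤ ℓ (Pi.single k 1, 0))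
    (hr : IsGluing r t) {v : κ} (hv : v ∉ Set.range t) :
    0 ≤ ∑ k, (r v).1 k * ℓ (Pi.single k 1, 0) ∧
      (∑ k, (r v).1 k * ℓ (Pi.single k 1, 0) = 0 → ∀ k, ℓ (Pi.single k 1, 0) = 0) := by
  have h0 : ∀ k ∈ Finset.univ, 0 ≤ (r v).1 k * ℓ (Pi.single k 1, 0) :=
    fun k _ => mul_nonneg (hr.pos v hv k).le (hc k)
  refine ⟨Finset.sum_nonneg h0, fun h k => ?_⟩
  have := (Finset.sum_eq_zero_iff_of_nonneg h0).1 h k (Finset.mem_univ _)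
  exact (mul_eq_zero.1 this).resolve_left (hr.pos v hv k).ne'

/-- A proper face of the upper half which is not the common triangle is a proper face. -/
theorem isConeFace_image (hr : IsGluing r t) {i : ι → κ} (hinj : Function.Injective i)
    (hi : Set.range i = {v | 0 ≤ (r v).2}) {σ : Set ι} (hσ : IsConeFace (r ∘ i) σ)
    (hne : i '' σ ≠ Set.range t) : IsConeFace r (i '' σ) := by
  obtain ⟨hu, ℓ, h0, h1⟩ := hσ
  refine ⟨fun h => hu (Set.eq_univ_of_forall fun v =>
    hinj.mem_set_image.1 (h ▸ Set.mem_univ (i v))), ?_⟩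
  -- Part of the triangle is exposed by the sum of the coordinates belonging to its absent vertices.
  -- Any other face keeps its own functional, which turns out to be positive below the hyperplane.
  by_cases hsub : i '' σ ⊆ Set.range t
  · classical
    obtain ⟨_, ⟨k₀, rfl⟩, hk₀⟩ := Set.exists_of_ssubset (hsub.ssubset_of_ne hne)
    let m : Module.Dual ℝ ((Fin 3 → ℝ) × ℝ) :=
      (∑ k, (if t k ∈ i '' σ then (0 : ℝ) else 1) • LinearMap.proj k) ∘ₗ LinearMap.fst ℝ _ ℝ
    have hm : ∀ w, m w = ∑ k, (if t k ∈ i '' σ then (0 : ℝ) else 1) * w.1 k := fun w => by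
      simp only [m, LinearMap.comp_apply, LinearMap.sum_apply, LinearMap.smul_apply,
        LinearMap.proj_apply, LinearMap.fst_apply, smul_eq_mul]
    have key : ∀ v, (v ∈ i '' σ ∧ m (r v) = 0) ∨ (v ∉ i '' σ ∧ 0 < m (r v)) := by
      intro v
      by_cases hv : v ∈ Set.range t
      · obtain ⟨l, rfl⟩ := hv
        have : m (r (t l)) = if t l ∈ i '' σ then (0 : ℝ) else 1 := by
          simp [hm, hr.base, Pi.single_apply]
        rw [this]
        by_cases h : t l ∈ i '' σ
        · exact Or.inl ⟨h, if_pos h⟩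
        · exact Or.inr ⟨h, by rw [if_neg h]; exact one_pos⟩
      · refine Or.inr ⟨fun h => hv (hsub h), ?_⟩
        rw [hm]
        refine Finset.sum_pos' (fun k _ => mul_nonneg (by split_ifs <;> norm_num)
          (hr.pos v hv k).le) ⟨k₀, Finset.mem_univ _, ?_⟩
        rw [if_neg hk₀, one_mul]
        exact hr.pos v hv k₀
    refine ⟨m, fun v => ?_, fun v => ?_⟩
    · rcases key v with h | h
      · exact h.2.ge
      · exact h.2.le
    · rcases key v with h | h
      · exact iff_of_true h.2 h.1
      · exact iff_of_false h.2.ne' h.1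
  · obtain ⟨_, ⟨s, hs, rfl⟩, hst⟩ := Set.not_subset.1 hsub
    have hc := hr.base_nonneg hi h0
    have hsum := sum_nonneg hc hr hst
    have hs0 : ℓ (r (i s)) = 0 := (h1 s).2 hs
    rw [dual_pi_prod_apply] at hs0
    have hpos : 0 < (r (i s)).2 :=
      lt_of_le_of_ne (hi ▸ Set.mem_range_self s : i s ∈ {v | 0 ≤ (r v).2}) (hr.ne_zero _ hst).symm
    -- Otherwise vanishing at a vertex strictly above the hyperplane would force `ℓ = 0`.
    have hd : ℓ (0, 1) < 0 := by
      by_contra! hd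
      have h2 := mul_nonneg hpos.le hd
      have h3 := hsum.2 (by linarith)
      have h4 : ℓ (0, 1) = 0 := (mul_eq_zero.1 (by linarith : (r (i s)).2 * ℓ (0, 1) = 0)).resolve_left
        hpos.ne'
      refine hu (Set.eq_univ_of_forall fun v => (h1 v).1 ?_)
      rw [dual_pi_prod_apply]
      simp [h3, h4]
    have hlow : ∀ v, v ∉ Set.range i → 0 < ℓ (r v) := by
      intro v hv
      rw [hi, Set.mem_ofPred_eq, not_le] at hv
      have hvt : v ∉ Set.range t := fun h => hv.ne ((hr.snd_eq_zero_iff v).2 h)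
      rw [dual_pi_prod_apply]
      exact add_pos_of_nonneg_of_pos (sum_nonneg hc hr hvt).1 (mul_pos_of_neg_of_neg hv hd)
    refine ⟨ℓ, fun v => ?_, fun v => ?_⟩ <;> by_cases hv : v ∈ Set.range i
    · obtain ⟨w, rfl⟩ := hv
      exact h0 w
    · exact (hlow v hv).le
    · obtain ⟨w, rfl⟩ := hv
      rw [hinj.mem_set_image]
      exact h1 w
    · exact iff_of_false (hlow v hv).ne' fun h => hv (Set.image_subset_range _ _ h)

/-- The sign of `ℓ (0, 1)` tells on which side a face lies. If it is nonpositive, a face vertex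
strictly below would force `ℓ = 0`; so would containing the whole triangle, because of the vertex
above. -/
theorem exists_of_isConeFace_of_nonpos (hr : IsGluing r t) {i : ι → κ}
    (hi : Set.range i = {v | 0 ≤ (r v).2}) (hup : ∃ v, 0 < (r v).2) {τ : Set κ}
    (hu : τ ≠ Set.univ) {ℓ : Module.Dual ℝ ((Fin 3 → ℝ) × ℝ)} (h0 : ∀ v, 0 ≤ ℓ (r v))
    (h1 : ∀ v, ℓ (r v) = 0 ↔ v ∈ τ) (hd : ℓ (0, 1) ≤ 0) :
    IsConeFace (r ∘ i) (i ⁻¹' τ) ∧ i '' (i ⁻¹' τ) = τ ∧ τ ≠ Set.range t := by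
  have hc := hr.base_nonneg hi fun v => h0 (i v)
  have hnz : (∀ k, ℓ (Pi.single k 1, 0) = 0) → ℓ (0, 1) = 0 → False := fun h3 h4 =>
    hu (Set.eq_univ_of_forall fun v => (h1 v).1 (by rw [dual_pi_prod_apply]; simp [h3, h4]))
  have hT : ¬ Set.range t ⊆ τ := by
    intro h
    have h3 : ∀ k, ℓ (Pi.single k 1, 0) = 0 := fun k => by
      rw [← hr.base]
      exact (h1 _).2 (h ⟨k, rfl⟩)
    obtain ⟨v, hv⟩ := hup
    have h4 := h0 v
    rw [dual_pi_prod_apply] at h4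
    simp only [h3, mul_zero, Finset.sum_const_zero, zero_add] at h4
    exact hnz h3 (le_antisymm hd (nonneg_of_mul_nonneg_right h4 hv))
  have hsub : τ ⊆ Set.range i := by
    intro v hv
    by_contra hvi
    rw [hi, Set.mem_ofPred_eq, not_le] at hvi
    have hvt : v ∉ Set.range t := fun h => hvi.ne ((hr.snd_eq_zero_iff v).2 h)
    have h2 := (h1 v).2 hv
    rw [dual_pi_prod_apply] at h2
    have h3 := sum_nonneg hc hr hvt
    have h4 := mul_nonneg_of_nonpos_of_nonpos hvi.le hd
    exact hnz (h3.2 (by linarith))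
      ((mul_eq_zero.1 (by linarith : (r v).2 * ℓ (0, 1) = 0)).resolve_left hvi.ne)
  refine ⟨⟨fun h => hT ?_, ℓ, fun v => h0 _, fun v => h1 _⟩,
    Set.image_preimage_eq_of_subset hsub, fun h => hT h.ge⟩
  rintro _ ⟨k, rfl⟩
  obtain ⟨v, hv⟩ : t k ∈ Set.range i := by simp [hi, hr.base]
  rw [← hv]
  exact (h ▸ Set.mem_univ v : v ∈ i ⁻¹' τ)

/-- The proper faces of a glued configuration are those of its two halves, except for the common
triangle. -/
theorem isConeFace_iff {ι' : Type*} (hr : IsGluing r t) {i : ι → κ} (hinj : Function.Injective i)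
    (hi : Set.range i = {v | 0 ≤ (r v).2}) (hup : ∃ v, 0 < (r v).2) {j : ι' → κ}
    (hjinj : Function.Injective j) (hj : Set.range j = {v | (r v).2 ≤ 0})
    (hlow : ∃ v, (r v).2 < 0) (τ : Set κ) :
    IsConeFace r τ ↔ (∃ σ, IsConeFace (r ∘ i) σ ∧ i '' σ ≠ Set.range t ∧ i '' σ = τ) ∨
      (∃ σ, IsConeFace (r ∘ j) σ ∧ j '' σ ≠ Set.range t ∧ j '' σ = τ) := by
  have hj' : Set.range j = {v | 0 ≤ ((fun v => reflectLast (r v)) v).2} := by simpa using hj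
  constructor
  · rintro ⟨hu, ℓ, h0, h1⟩
    rcases le_total (ℓ (0, 1)) 0 with hd | hd
    · obtain ⟨h2, h3, h4⟩ := hr.exists_of_isConeFace_of_nonpos hi hup hu h0 h1 hd
      exact Or.inl ⟨_, h2, by rwa [h3], h3⟩
    -- The reflection exchanges the halves and the sign of `ℓ (0, 1)`.
    · have hrr : ∀ w : (Fin 3 → ℝ) × ℝ,
          (ℓ ∘ₗ reflectLast.toLinearMap) (reflectLast w) = ℓ w := fun w => by simp
      obtain ⟨h2, h3, h4⟩ := hr.reflect.exists_of_isConeFace_of_nonpos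
        (ℓ := ℓ ∘ₗ reflectLast.toLinearMap) hj' (by simpa using hlow) hu
        (fun v => by rw [hrr]; exact h0 v) (fun v => by rw [hrr]; exact h1 v) (by
          have : ((0 : Fin 3 → ℝ), (-1 : ℝ)) = -(0, 1) := by simp
          simpa [this, -Prod.neg_mk] using hd)
      exact Or.inr ⟨_, (isConeFace_equiv reflectLast (r ∘ j) _).1 h2, by rwa [h3], h3⟩
  · rintro (⟨σ, h1, h2, rfl⟩ | ⟨σ, h1, h2, rfl⟩)
    · exact hr.isConeFace_image hinj hi h1 h2
    · exact (isConeFace_equiv reflectLast r _).1 (hr.reflect.isConeFace_image hjinj hj'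
        ((isConeFace_equiv reflectLast (r ∘ j) _).2 h1) h2)

end IsGluing

/-! ### Coordinates adapted to a triangle. -/

theorem exists_equiv_coordinates {V : Type*} [AddCommGroup V] [Module ℝ V]
    (hV : Module.finrank ℝ V = 4) (X : Fin 3 → Module.Dual ℝ V) (H : Module.Dual ℝ V)
    (w : Fin 3 → V) (hX : ∀ k l, X l (w k) = (Pi.single k 1 : Fin 3 → ℝ) l) (hH : ∀ k, H (w k) = 0)
    (hH0 : H ≠ 0) : ∃ A : V ≃ₗ[ℝ] (Fin 3 → ℝ) × ℝ, ∀ v, A v = (fun k => X k v, H v) := by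
  have : FiniteDimensional ℝ V := FiniteDimensional.of_finrank_pos (by omega)
  let A₀ : V →ₗ[ℝ] (Fin 3 → ℝ) × ℝ := (LinearMap.pi X).prod H
  have hA₀ : Function.Surjective A₀ := by
    obtain ⟨u, hu⟩ : ∃ u, H u ≠ 0 := by
      by_contra! h
      exact hH0 (LinearMap.ext h)
    rintro ⟨x, h⟩
    -- The multiple of `u` produces the last coordinate; the `w k` correct the others without
    -- disturbing it.
    refine ⟨∑ k, (x k - h / H u * X k u) • w k + (h / H u) • u, ?_⟩
    refine Prod.ext ?_ ?_
    · ext l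
      simp [A₀, hX, Pi.single_apply]
    · simp [A₀, hH, hu]
  have hfin : Module.finrank ℝ V = Module.finrank ℝ ((Fin 3 → ℝ) × ℝ) := by simp [hV]
  exact ⟨LinearEquiv.ofBijective A₀
    ⟨(LinearMap.injective_iff_surjective_of_finrank_eq_finrank hfin).2 hA₀, hA₀⟩, fun v => rfl⟩

/-- Coordinates in which a facet is spanned by coordinate vectors and everything else lies above its
relative interior. -/
theorem IsSimplicialConfig.exists_facet_coordinates {ι V : Type*} [Finite ι] [AddCommGroup V]
    [Module ℝ V] (hV : Module.finrank ℝ V = 4) {p : ι → V} (hp : IsSimplicialConfig p)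
    {a : Fin 3 → ι} (ha : Function.Injective a) (hF : IsConeFace p (Set.range a)) :
    ∃ A : V ≃ₗ[ℝ] (Fin 3 → ℝ) × ℝ, (∀ k, A (p (a k)) = (Pi.single k 1, 0)) ∧
      ∀ v, v ∉ Set.range a → (∀ k, 0 < (A (p v)).1 k) ∧ 0 < (A (p v)).2 := by
  have hli := hp.linearIndependent_comp ha hF
  obtain ⟨hu, H, h0, h1⟩ := hF
  have hH : ∀ v, v ∉ Set.range a → 0 < H (p v) := fun v hv => IsConeFace.pos h0 h1 hv
  choose m hm using fun l : Fin 3 => hli.exists_dual_eq fun k => (Pi.single k 1 : Fin 3 → ℝ) l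
  -- Adding multiples of `H` preserves the dual coordinates on the facet and makes them positive off
  -- it.
  choose N hN using fun l : Fin 3 =>
    exists_pos_add_mul (Set.range a) (fun v => m l (p v)) (fun v => H (p v)) hH
  have ha0 : ∀ k, H (p (a k)) = 0 := fun k => (h1 _).2 ⟨k, rfl⟩
  have hX : ∀ k l, (m l + N l • H) (p (a k)) = (Pi.single k 1 : Fin 3 → ℝ) l := fun k l => by
    have := hm l k
    rw [Function.comp_apply] at this
    simp [this, ha0]
  obtain ⟨A, hA⟩ := exists_equiv_coordinates hV (fun l => m l + N l • H) H (p ∘ a) hX ha0 (by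
    rintro rfl
    exact hu (Set.eq_univ_of_forall fun i => (h1 i).1 rfl))
  refine ⟨A, fun k => ?_, fun v hv => ⟨fun l => ?_, ?_⟩⟩
  · rw [hA]
    exact Prod.ext (funext fun l => hX k l) (ha0 k)
  · rw [hA]
    exact hN l v hv
  · rw [hA]
    exact hH v hv

/-! ### Simpliciality of the halves and of the whole. -/

namespace IsGluing

variable {κ ι ι' : Type*} {r : κ → (Fin 3 → ℝ) × ℝ} {t : Fin 3 → κ}

theorem singleton_ne (hr : IsGluing r t) (v : κ) : {v} ≠ Set.range t := fun h =>
  Fin.zero_ne_one (hr.injective ((h.ge ⟨0, rfl⟩ : t 0 = v).trans (h.ge ⟨1, rfl⟩ : t 1 = v).symm))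

theorem empty_ne : ∅ ≠ Set.range t := fun h => (h.ge ⟨0, rfl⟩ : t 0 ∈ (∅ : Set κ))

theorem isConeFace_base (hr : IsGluing r t) {i : ι → κ} (hi : Set.range i = {v | 0 ≤ (r v).2})
    (hup : ∃ v, 0 < (r v).2) {a : Fin 3 → ι} (hinj : Function.Injective i)
    (ha : ∀ k, i (a k) = t k) : IsConeFace (r ∘ i) (Set.range a) := by
  have h : ∀ v, (r (i v)).2 = 0 ↔ v ∈ Set.range a := fun v => by
    rw [hr.snd_eq_zero_iff]
    constructor
    · rintro ⟨k, hk⟩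
      exact ⟨k, hinj ((ha k).trans hk)⟩
    · rintro ⟨k, rfl⟩
      exact ⟨k, (ha k).symm⟩
  refine ⟨fun hu => ?_, LinearMap.snd ℝ _ ℝ,
    fun v => (hi ▸ Set.mem_range_self v : i v ∈ {v | 0 ≤ (r v).2}), h⟩
  obtain ⟨v, hv⟩ := hup
  obtain ⟨w, rfl⟩ : v ∈ Set.range i := by rw [hi]; exact hv.le
  exact hv.ne' ((h w).2 (hu ▸ Set.mem_univ w))

theorem linearIndependent_base (hr : IsGluing r t) : LinearIndependent ℝ (r ∘ t) := by
  have h := (Pi.basisFun ℝ (Fin 3)).linearIndependent.map' (LinearMap.inl ℝ (Fin 3 → ℝ) ℝ)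
    (LinearMap.ker_eq_bot.2 LinearMap.inl_injective)
  have e : r ∘ t = LinearMap.inl ℝ (Fin 3 → ℝ) ℝ ∘ Pi.basisFun ℝ (Fin 3) :=
    funext fun k => by simp [hr.base]
  rw [e]
  exact h

theorem linearIndependent_image_iff {i : ι → κ} (hinj : Function.Injective i) (σ : Set ι) :
    LinearIndependent ℝ (fun v : i '' σ => r v) ↔ LinearIndependent ℝ (fun v : σ => r (i v)) :=
  (linearIndependent_equiv (Equiv.Set.image i σ hinj)).symm

/-- A glued configuration is simplicial if its halves are. -/
theorem isSimplicialConfig (hr : IsGluing r t) {i : ι → κ} (hinj : Function.Injective i)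
    (hi : Set.range i = {v | 0 ≤ (r v).2}) (hup : ∃ v, 0 < (r v).2) {j : ι' → κ}
    (hjinj : Function.Injective j) (hj : Set.range j = {v | (r v).2 ≤ 0})
    (hlow : ∃ v, (r v).2 < 0) (h1 : IsSimplicialConfig (r ∘ i)) (h2 : IsSimplicialConfig (r ∘ j)) :
    IsSimplicialConfig r where
  spanning ℓ h := h1.spanning ℓ fun v => h (i v)
  empty := (hr.isConeFace_iff hinj hi hup hjinj hj hlow _).2
    (Or.inl ⟨∅, h1.empty, by rw [Set.image_empty]; exact empty_ne, Set.image_empty _⟩)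
  vertex v := by
    refine (hr.isConeFace_iff hinj hi hup hjinj hj hlow _).2 ?_
    rcases le_total 0 (r v).2 with hv | hv
    · obtain ⟨w, rfl⟩ : v ∈ Set.range i := by rw [hi]; exact hv
      exact Or.inl ⟨{w}, h1.vertex w, by rw [Set.image_singleton]; exact hr.singleton_ne _,
        Set.image_singleton⟩
    · obtain ⟨w, rfl⟩ : v ∈ Set.range j := by rw [hj]; exact hv
      exact Or.inr ⟨{w}, h2.vertex w, by rw [Set.image_singleton]; exact hr.singleton_ne _,
        Set.image_singleton⟩
  simplicial τ hτ := by
    rcases (hr.isConeFace_iff hinj hi hup hjinj hj hlow _).1 hτ with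
      ⟨σ, h, -, rfl⟩ | ⟨σ, h, -, rfl⟩
    · exact (linearIndependent_image_iff hinj σ).2 (h1.simplicial σ h)
    · exact (linearIndependent_image_iff hjinj σ).2 (h2.simplicial σ h)

/-- The upper half of a simplicial glued configuration is simplicial. -/
theorem isSimplicialConfig_comp (hr : IsGluing r t) {i : ι → κ} (hinj : Function.Injective i)
    (hi : Set.range i = {v | 0 ≤ (r v).2}) (hup : ∃ v, 0 < (r v).2) (h : IsSimplicialConfig r) :
    IsSimplicialConfig (r ∘ i) := by
  have hmem : ∀ v, 0 ≤ (r v).2 → ∃ w, i w = v := fun v hv => by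
    rwa [← Set.mem_range, hi]
  choose a ha using fun k => hmem (t k) (by simp [hr.base])
  have hne : ∀ σ : Set ι, IsConeFace r (i '' σ) →
      ¬ Set.range t ⊆ i '' σ → IsConeFace (r ∘ i) σ := by
    rintro σ ⟨-, ℓ, h0, h1⟩ hT
    refine ⟨?_, ℓ, fun v => h0 _, fun v => (h1 _).trans hinj.mem_set_image⟩
    rintro rfl
    refine hT ?_
    rintro _ ⟨k, rfl⟩
    exact ⟨a k, trivial, ha k⟩
  refine ⟨fun ℓ hℓ => ?_, hne ∅ ?_ ?_, fun v => hne {v} ?_ ?_, fun σ hσ => ?_⟩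
  · have h3 : ∀ k, ℓ (Pi.single k 1, 0) = 0 := fun k => by
      rw [← hr.base, ← ha]
      exact hℓ _
    obtain ⟨v, hv⟩ := hup
    obtain ⟨w, rfl⟩ := hmem v hv.le
    have h4 := hℓ w
    rw [Function.comp_apply, dual_pi_prod_apply] at h4
    simp only [h3, mul_zero, Finset.sum_const_zero, zero_add, mul_eq_zero, hv.ne', false_or] at h4
    ext w
    · simpa using by rw [dual_pi_prod_apply]; simp [h3, h4]
    · simpa using h4
  · rw [Set.image_empty]; exact h.empty
  · rw [Set.image_empty]; exact fun h => h ⟨0, rfl⟩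
  · rw [Set.image_singleton]; exact h.vertex _
  · rw [Set.image_singleton]
    intro h
    exact Fin.zero_ne_one (hr.injective ((h ⟨0, rfl⟩ : t 0 = i v).trans (h ⟨1, rfl⟩ : t 1 = i v).symm))
  · refine (linearIndependent_image_iff hinj σ).1 ?_
    -- The common triangle is the one face of the half that need not be a face of the whole; it is
    -- spanned by coordinate vectors.
    by_cases hT : i '' σ = Set.range t
    · rw [hT]
      exact (linearIndependent_equiv' (Equiv.ofInjective t hr.injective) rfl).1
        hr.linearIndependent_base
    · exact h.simplicial _ (hr.isConeFace_image hinj hi hσ hT)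

end IsGluing

/-! ### Connected sums along labelled facets. -/

namespace SimplicialPolytope

/-- `R` is the connected sum of `P` and `Q` in which the vertex `a k` of `P` is identified with the
vertex `b k` of `Q`. -/
structure IsSumAlong {P Q R : SimplicialPolytope} (a : Fin 3 → P.Vertex) (b : Fin 3 → Q.Vertex)
    (i : P.Vertex ↪ R.Vertex) (j : Q.Vertex ↪ R.Vertex) : Prop where
  facet_left : P.IsFacet (Set.range a)
  facet_right : Q.IsFacet (Set.range b)
  comm : ∀ k, i (a k) = j (b k)
  inter : Set.range i ∩ Set.range j ⊆ i '' Set.range a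
  union : Set.range i ∪ Set.range j = Set.univ
  isFace_iff : ∀ τ : Set R.Vertex, R.IsFace τ ↔
    (∃ σ : Set P.Vertex, P.IsFace σ ∧ σ ≠ Set.range a ∧ i '' σ = τ) ∨
    (∃ σ : Set Q.Vertex, Q.IsFace σ ∧ σ ≠ Set.range b ∧ j '' σ = τ)

theorem image_range_eq {α β γ κ : Type*} {a : κ → α} {b : κ → β} {i : α → γ} {j : β → γ}
    (h : ∀ k, i (a k) = j (b k)) : i '' Set.range a = j '' Set.range b := by
  rw [← Set.range_comp, ← Set.range_comp]
  exact congrArg Set.range (funext h)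

theorem exists_fin_three_range {α : Type*} {F : Set α} (h : F.ncard = 3) :
    ∃ a : Fin 3 → α, Set.range a = F := by
  obtain ⟨x, y, z, -, -, -, rfl⟩ := Set.ncard_eq_three.1 h
  exact ⟨![x, y, z], by
    rw [Matrix.range_cons, Matrix.range_cons, Matrix.range_cons, Matrix.range_empty,
      Set.union_empty]
    rfl⟩

theorem injective_of_ncard_range {α : Type*} {a : Fin 3 → α} (h : (Set.range a).ncard = 3) :
    Function.Injective a := by
  rw [← Set.injOn_univ, ← Set.ncard_image_iff Set.finite_univ, Set.image_univ, h]
  simp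

theorem ncard_range_of_injective {α : Type*} {a : Fin 3 → α} (h : Function.Injective a) :
    (Set.range a).ncard = 3 := by
  rw [← Set.image_univ, Set.ncard_image_of_injective _ h]
  simp

variable {P Q R : SimplicialPolytope}

/-- With both facets labelled by `Fin 3`, the identification is `a k ↔ b k`, and permuting the
labels of one facet runs through all identifications. -/
theorem isConnectedSum_iff : IsConnectedSum P Q R ↔
    ∃ (a : Fin 3 → P.Vertex) (b : Fin 3 → Q.Vertex) (i : P.Vertex ↪ R.Vertex)
      (j : Q.Vertex ↪ R.Vertex), IsSumAlong a b i j := by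
  constructor
  · rintro ⟨F, G, i, j, hF, hG, hFG, hinter, hunion, hface⟩
    obtain ⟨a, rfl⟩ := exists_fin_three_range hF.2
    have h : ∀ k, ∃ y ∈ G, j y = i (a k) := fun k =>
      hFG.le (Set.mem_image_of_mem i ⟨k, rfl⟩)
    choose b hbG hb using h
    have hG' : Set.range b = G := j.injective.image_injective (by
      rw [← hFG]
      exact (image_range_eq (a := b) (b := a) hb))
    subst hG'
    exact ⟨a, b, i, j, hF, hG, fun k => (hb k).symm, hinter.le, hunion, hface⟩
  · rintro ⟨a, b, i, j, h⟩
    refine ⟨_, _, i, j, h.facet_left, h.facet_right, image_range_eq h.comm,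
      h.inter.antisymm (Set.subset_inter (Set.image_subset_range _ _) ?_), h.union, h.isFace_iff⟩
    rw [image_range_eq h.comm]
    exact Set.image_subset_range _ _

theorem exists_image_face_iff {κ ι μ : Type*} {p : ι → (Fin 3 → ℝ) × ℝ} {i : ι → κ}
    (hinj : Function.Injective i) (eP : ι ≃ P.Vertex)
    (hP : ∀ σ, P.IsFace (eP '' σ) ↔ IsConeFace p σ) {f : κ → μ} (hf : Function.Injective f)
    {a : Fin 3 → ι} {t : Fin 3 → κ} (ha : ∀ k, i (a k) = t k) (τ : Set κ) :
    (∃ σ, IsConeFace p σ ∧ i '' σ ≠ Set.range t ∧ i '' σ = τ) ↔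
      ∃ σ, P.IsFace σ ∧ σ ≠ Set.range (eP ∘ a) ∧ (fun v => f (i (eP.symm v))) '' σ = f '' τ := by
  rw [eP.surjective.image_surjective.exists]
  refine exists_congr fun σ => and_congr (hP σ).symm (and_congr (not_congr ?_) ?_)
  · have : Set.range t = i '' Set.range a := by
      rw [← Set.range_comp]
      exact congrArg Set.range (funext fun k => (ha k).symm)
    rw [this, Set.range_comp, hinj.image_injective.eq_iff, eP.injective.image_injective.eq_iff]
  · rw [← hf.image_injective.eq_iff, Set.image_image, Set.image_image]
    simp only [Equiv.symm_apply_apply]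

/-- Polytopes realizing the two halves of a glued configuration and the whole configuration form a
connected sum. -/
theorem isSumAlong_of_isGluing {κ ι ι' : Type*} {r : κ → (Fin 3 → ℝ) × ℝ} {t : Fin 3 → κ}
    (hr : IsGluing r t) {i : ι → κ} (hinj : Function.Injective i)
    (hi : Set.range i = {v | 0 ≤ (r v).2}) (hup : ∃ v, 0 < (r v).2) {j : ι' → κ}
    (hjinj : Function.Injective j) (hj : Set.range j = {v | (r v).2 ≤ 0})
    (hlow : ∃ v, (r v).2 < 0)
    (eP : ι ≃ P.Vertex) (hP : ∀ σ, P.IsFace (eP '' σ) ↔ IsConeFace (r ∘ i) σ)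
    (eQ : ι' ≃ Q.Vertex) (hQ : ∀ σ, Q.IsFace (eQ '' σ) ↔ IsConeFace (r ∘ j) σ)
    (eR : κ ≃ R.Vertex) (hR : ∀ σ, R.IsFace (eR '' σ) ↔ IsConeFace r σ)
    {a : Fin 3 → ι} (ha : ∀ k, i (a k) = t k) {b : Fin 3 → ι'} (hb : ∀ k, j (b k) = t k) :
    IsSumAlong (eP ∘ a) (eQ ∘ b)
      ((eP.symm.toEmbedding.trans ⟨i, hinj⟩).trans eR.toEmbedding)
      ((eQ.symm.toEmbedding.trans ⟨j, hjinj⟩).trans eR.toEmbedding) where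
  facet_left := by
    refine ⟨?_, ncard_range_of_injective (eP.injective.comp fun k l h => hr.injective ?_)⟩
    · rw [Set.range_comp, hP]
      exact hr.isConeFace_base hi hup hinj ha
    · rw [← ha, ← ha, h]
  facet_right := by
    refine ⟨?_, ncard_range_of_injective (eQ.injective.comp fun k l h => hr.injective ?_)⟩
    · rw [Set.range_comp, hQ, ← isConeFace_equiv reflectLast]
      exact hr.reflect.isConeFace_base (by simpa using hj) (by simpa using hlow) hjinj hb
    · rw [← hb, ← hb, h]
  comm k := by simp [ha, hb]
  inter := by
    rintro _ ⟨⟨x, rfl⟩, ⟨y, hy⟩⟩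
    have hxy : j (eQ.symm y) = i (eP.symm x) := eR.injective hy
    have h1 : 0 ≤ (r (i (eP.symm x))).2 :=
      (hi ▸ Set.mem_range_self _ : i (eP.symm x) ∈ {v | 0 ≤ (r v).2})
    have h2 : (r (i (eP.symm x))).2 ≤ 0 :=
      hxy ▸ (hj ▸ Set.mem_range_self _ : j (eQ.symm y) ∈ {v | (r v).2 ≤ 0})
    obtain ⟨k, hk⟩ := (hr.snd_eq_zero_iff _).1 (le_antisymm h2 h1)
    refine ⟨x, ⟨k, ?_⟩, rfl⟩
    rw [← ha] at hk
    rw [Function.comp_apply, hinj hk, Equiv.apply_symm_apply]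
  union := by
    refine Set.eq_univ_of_forall fun x => ?_
    obtain ⟨v, rfl⟩ := eR.surjective x
    rcases le_total 0 (r v).2 with h | h
    · obtain ⟨w, rfl⟩ : v ∈ Set.range i := by rw [hi]; exact h
      exact Or.inl ⟨eP w, by simp⟩
    · obtain ⟨w, rfl⟩ : v ∈ Set.range j := by rw [hj]; exact h
      exact Or.inr ⟨eQ w, by simp⟩
  isFace_iff τ := by
    obtain ⟨τ, rfl⟩ := eR.surjective.image_surjective τ
    rw [hR, hr.isConeFace_iff hinj hi hup hjinj hj hlow]
    exact or_congr (exists_image_face_iff hinj eP hP eR.injective ha τ)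
      (exists_image_face_iff hjinj eQ hQ eR.injective hb τ)

end SimplicialPolytope

/-! ### Gluing polytopes, and splitting along a missing triangle. -/

namespace SimplicialPolytope

variable {P Q R : SimplicialPolytope}

theorem finrank_homogeneous : Module.finrank ℝ (EuclideanSpace ℝ (Fin 3) × ℝ) = 4 := by
  rw [Module.finrank_prod, finrank_euclideanSpace_fin, Module.finrank_self]

/-- Polytopes can be glued along any facets, by any identification of their vertices. -/
theorem exists_isSumAlong {a : Fin 3 → P.Vertex} {b : Fin 3 → Q.Vertex}
    (ha : P.IsFacet (Set.range a)) (hb : Q.IsFacet (Set.range b)) :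
    ∃ (R : SimplicialPolytope) (i : P.Vertex ↪ R.Vertex) (j : Q.Vertex ↪ R.Vertex),
      IsSumAlong a b i j := by
  have hPc := P.isSimplicialConfig_lift
  have hQc := Q.isSimplicialConfig_lift
  obtain ⟨A, hA0, hA1⟩ := hPc.exists_facet_coordinates finrank_homogeneous
    (injective_of_ncard_range ha.2) ((P.isFace_iff _).1 ha.1)
  obtain ⟨B, hB0, hB1⟩ := hQc.exists_facet_coordinates finrank_homogeneous
    (injective_of_ncard_range hb.2) ((Q.isFace_iff _).1 hb.1)
  let p : P.Vertex → (Fin 3 → ℝ) × ℝ := fun v => A (P.lift v)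
  -- `Q` is reflected to lie below the hyperplane, with its facet on the same coordinate vectors as
  -- that of `P`.
  let q : Q.Vertex → (Fin 3 → ℝ) × ℝ := fun v => reflectLast (B (Q.lift v))
  have hp : IsSimplicialConfig p := hPc.equiv A
  have hq : IsSimplicialConfig q := (hQc.equiv B).equiv reflectLast
  have hp0 : ∀ k, p (a k) = (Pi.single k 1, 0) := hA0
  have hq0 : ∀ k, q (b k) = (Pi.single k 1, 0) := fun k => by simp [q, hB0]
  have hp1 : ∀ v, v ∉ Set.range a → (∀ k, 0 < (p v).1 k) ∧ 0 < (p v).2 := hA1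
  have hq1 : ∀ v, v ∉ Set.range b → (∀ k, 0 < (q v).1 k) ∧ (q v).2 < 0 := fun v hv => by
    simpa [q] using hB1 v hv
  have hp2 : ∀ v, 0 ≤ (p v).2 := fun v => by
    by_cases hv : v ∈ Set.range a
    · obtain ⟨k, rfl⟩ := hv
      simp [hp0]
    · exact (hp1 v hv).2.le
  have hq2 : ∀ v, (q v).2 ≤ 0 := fun v => by
    by_cases hv : v ∈ Set.range b
    · obtain ⟨k, rfl⟩ := hv
      simp [hq0]
    · exact (hq1 v hv).2.le
  let κ := ↥(Set.range p ∪ Set.range q)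
  let r : κ → (Fin 3 → ℝ) × ℝ := Subtype.val
  let i : P.Vertex → κ := fun v => ⟨p v, Or.inl ⟨v, rfl⟩⟩
  let j : Q.Vertex → κ := fun v => ⟨q v, Or.inr ⟨v, rfl⟩⟩
  have hinj : Function.Injective i := fun v w h => hp.injective (Subtype.mk.inj h)
  have hjinj : Function.Injective j := fun v w h => hq.injective (Subtype.mk.inj h)
  have hij : ∀ k, j (b k) = i (a k) := fun k => Subtype.ext ((hq0 k).trans (hp0 k).symm)
  have hr : IsGluing r (i ∘ a) := by
    refine ⟨hp0, ?_, ?_⟩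
    · rintro ⟨_, ⟨v, rfl⟩ | ⟨v, rfl⟩⟩ hv
      · exact (hp1 v fun ⟨k, hk⟩ => hv ⟨k, congrArg i hk⟩).1
      · exact (hq1 v fun ⟨k, hk⟩ => hv ⟨k, (hij k).symm.trans (congrArg j hk)⟩).1
    · rintro ⟨_, ⟨v, rfl⟩ | ⟨v, rfl⟩⟩ hv
      · exact (hp1 v fun ⟨k, hk⟩ => hv ⟨k, congrArg i hk⟩).2.ne'
      · exact (hq1 v fun ⟨k, hk⟩ => hv ⟨k, (hij k).symm.trans (congrArg j hk)⟩).2.ne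
  have hi : Set.range i = {v | 0 ≤ (r v).2} := by
    refine subset_antisymm (by rintro _ ⟨v, rfl⟩; exact hp2 v) ?_
    rintro ⟨_, ⟨v, rfl⟩ | ⟨v, rfl⟩⟩ hv
    · exact ⟨v, rfl⟩
    · obtain ⟨k, rfl⟩ : v ∈ Set.range b := by_contra fun h => (hq1 v h).2.not_ge hv
      exact ⟨a k, (hij k).symm⟩
  have hj : Set.range j = {v | (r v).2 ≤ 0} := by
    refine subset_antisymm (by rintro _ ⟨v, rfl⟩; exact hq2 v) ?_
    rintro ⟨_, ⟨v, rfl⟩ | ⟨v, rfl⟩⟩ hv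
    · obtain ⟨k, rfl⟩ : v ∈ Set.range a := by_contra fun h => (hp1 v h).2.not_ge hv
      exact ⟨b k, hij k⟩
    · exact ⟨v, rfl⟩
  have hup : ∃ v, 0 < (r v).2 := by
    obtain ⟨v, hv⟩ := (Set.ne_univ_iff_exists_notMem _).1 ((P.isFace_iff _).1 ha.1).1
    exact ⟨i v, (hp1 v hv).2⟩
  have hlow : ∃ v, (r v).2 < 0 := by
    obtain ⟨v, hv⟩ := (Set.ne_univ_iff_exists_notMem _).1 ((Q.isFace_iff _).1 hb.1).1
    exact ⟨j v, (hq1 v hv).2⟩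
  have : Finite κ := ((Set.finite_range p).union (Set.finite_range q)).to_subtype
  obtain ⟨R, e, he⟩ := exists_realization (by simp)
    (hr.isSimplicialConfig hinj hi hup hjinj hj hlow hp hq)
  refine ⟨R, _, _, isSumAlong_of_isGluing hr hinj hi hup hjinj hj hlow (Equiv.refl _) (fun σ => ?_)
    (Equiv.refl _) (fun σ => ?_) e he (fun k => rfl) hij⟩
  · rw [Equiv.coe_refl, Set.image_id, isFace_iff]
    exact (isConeFace_equiv A P.lift σ).symm
  · rw [Equiv.coe_refl, Set.image_id, isFace_iff, ← isConeFace_equiv B]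
    exact (isConeFace_equiv reflectLast _ σ).symm

/-- A polytope with a triangle of edges which does not bound a facet is a connected sum. -/
theorem exists_isConnectedSum_of_missing_triangle {t : Fin 3 → P.Vertex}
    (ht : Function.Injective t) (hpair : ∀ k, P.IsFace (Set.range t \ {t k}))
    (hT : ¬ P.IsFace (Set.range t)) : ∃ P₁ P₂ : SimplicialPolytope, IsConnectedSum P₁ P₂ P := by
  have hPc := P.isSimplicialConfig_lift
  simp only [isFace_iff] at hpair hT
  -- `ℓ k` exposes the edge opposite `t k`. Normalized at `t k`, these three functionals are the
  -- first three coordinates, positive off the triangle.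
  choose hu ℓ h0 h1 using hpair
  have hpos : ∀ k, 0 < ℓ k (P.lift (t k)) := fun k =>
    IsConeFace.pos (h0 k) (h1 k) (fun h => h.2 rfl)
  -- Three vectors do not span a four-dimensional space.
  obtain ⟨H, hH0, hH⟩ : ∃ H : Module.Dual ℝ (EuclideanSpace ℝ (Fin 3) × ℝ), H ≠ 0 ∧
      ∀ k, H (P.lift (t k)) = 0 := by
    have hlt : Submodule.span ℝ (Set.range (P.lift ∘ t)) < ⊤ := by
      rw [lt_top_iff_ne_top]
      intro h
      have h2 := finrank_range_le_card (R := ℝ) (P.lift ∘ t)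
      rw [Set.finrank, h, finrank_top, finrank_homogeneous] at h2
      simp at h2
    obtain ⟨H, hH0, hH⟩ := Submodule.exists_le_ker_of_lt_top _ hlt
    exact ⟨H, hH0, fun k => hH (Submodule.subset_span ⟨k, rfl⟩)⟩
  obtain ⟨A, hA⟩ := exists_equiv_coordinates finrank_homogeneous
    (fun k => (ℓ k (P.lift (t k)))⁻¹ • ℓ k) H (P.lift ∘ t) (fun k l => by
      by_cases hkl : l = k
      · subst hkl
        simp [(hpos l).ne']
      · have : ℓ l (P.lift (t k)) = 0 := (h1 l _).2 ⟨⟨k, rfl⟩, fun h => hkl (ht h).symm⟩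
        simp [this, hkl]) hH hH0
  let r : P.Vertex → (Fin 3 → ℝ) × ℝ := fun v => A (P.lift v)
  have hrc : IsSimplicialConfig r := hPc.equiv A
  have hface : ∀ σ, IsConeFace r σ ↔ IsConeFace P.lift σ := isConeFace_equiv A P.lift
  have hbase : ∀ k, r (t k) = (Pi.single k 1, 0) := fun k => by
    simp only [r, hA, hH]
    refine Prod.ext (funext fun l => ?_) rfl
    by_cases hkl : l = k
    · subst hkl
      simp [(hpos l).ne']
    · have : ℓ l (P.lift (t k)) = 0 := (h1 l _).2 ⟨⟨k, rfl⟩, fun h => hkl (ht h).symm⟩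
      simp [this, hkl]
  have hoff : ∀ v, v ∉ Set.range t → ∀ k, 0 < (r v).1 k := fun v hv k => by
    simp only [r, hA]
    exact mul_pos (inv_pos.2 (hpos k)) (IsConeFace.pos (h0 k) (h1 k) fun h => hv h.1)
  have hr : IsGluing r t := by
    -- A further vertex on the hyperplane would be a positive combination of the triangle's
    -- vertices, so a functional exposing it would vanish on them too.
    refine ⟨hbase, hoff, fun v hv h => ?_⟩
    obtain ⟨-, m, hm0, hm1⟩ := hrc.vertex v
    have h2 := (hm1 v).2 rfl
    rw [dual_pi_prod_apply, h, zero_mul, add_zero] at h2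
    have h3 := (Finset.sum_eq_zero_iff_of_nonneg fun k _ => mul_nonneg (hoff v hv k).le
      (hbase k ▸ hm0 (t k))).1 h2 0 (Finset.mem_univ _)
    have h4 := (mul_eq_zero.1 h3).resolve_left (hoff v hv 0).ne'
    rw [← hbase, hm1] at h4
    exact hv ⟨0, h4⟩
  -- If all vertices were on one side of the hyperplane, it would expose the triangle as a face.
  have hex : ∀ m : Module.Dual ℝ ((Fin 3 → ℝ) × ℝ), (∀ v, 0 ≤ m (r v)) →
      (∀ v, m (r v) = 0 ↔ (r v).2 = 0) → False := fun m hm0 hm1 => by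
    refine hT ((hface _).1 ⟨fun h => ?_, m, hm0, fun v => (hm1 v).trans (hr.snd_eq_zero_iff v)⟩)
    refine hH0 (P.spanning_lift H fun v => ?_)
    obtain ⟨k, rfl⟩ : v ∈ Set.range t := h ▸ Set.mem_univ v
    exact hH k
  have hup : ∃ v, 0 < (r v).2 := by
    by_contra! h
    exact hex (-LinearMap.snd ℝ _ ℝ) (by simpa using h) (by simp)
  have hlow : ∃ v, (r v).2 < 0 := by
    by_contra! h
    exact hex (LinearMap.snd ℝ _ ℝ) (by simpa using h) (by simp)
  let i : {v // 0 ≤ (r v).2} → P.Vertex := Subtype.val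
  let j : {v // (r v).2 ≤ 0} → P.Vertex := Subtype.val
  have hi : Set.range i = {v | 0 ≤ (r v).2} := Subtype.range_coe_subtype
  have hj : Set.range j = {v | (r v).2 ≤ 0} := Subtype.range_coe_subtype
  have hcP : IsSimplicialConfig (r ∘ i) :=
    hr.isSimplicialConfig_comp Subtype.val_injective hi hup hrc
  have hcQ : IsSimplicialConfig (r ∘ j) := by
    have := (hr.reflect.isSimplicialConfig_comp (i := j) Subtype.val_injective (by simpa using hj)
      (by simpa using hlow) (hrc.equiv reflectLast)).equiv reflectLast
    simpa [Function.comp_def] using this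
  obtain ⟨P₁, e₁, he₁⟩ := exists_realization (by simp) hcP
  obtain ⟨P₂, e₂, he₂⟩ := exists_realization (by simp) hcQ
  exact ⟨P₁, P₂, isConnectedSum_iff.2 ⟨_, _, _, _,
    isSumAlong_of_isGluing hr Subtype.val_injective hi hup Subtype.val_injective hj hlow e₁ he₁ e₂ he₂
      (Equiv.refl _) (fun σ => by rw [Equiv.coe_refl, Set.image_id, isFace_iff, hface])
      (a := fun k => ⟨t k, by simp [hbase]⟩) (fun k => rfl)
      (b := fun k => ⟨t k, by simp [hbase]⟩) (fun k => rfl)⟩⟩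

end SimplicialPolytope

/-! ### Missing triangles and degrees in connected sums. -/

namespace SimplicialPolytope

variable {P Q R : SimplicialPolytope}

theorem IsFace.mono {σ τ : Set P.Vertex} (h : P.IsFace σ) (hτ : τ ⊆ σ) : P.IsFace τ :=
  (P.isFace_iff τ).2 (P.isSimplicialConfig_lift.mono ((P.isFace_iff σ).1 h) hτ)

/-- Three pairwise adjacent vertices which do not span a facet. -/
def IsMissingTriangle (P : SimplicialPolytope) (T : Set P.Vertex) : Prop :=
  T.ncard = 3 ∧ (∀ u ∈ T, ∀ v ∈ T, P.IsFace {u, v}) ∧ ¬ P.IsFace T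

theorem Irreducible.not_isMissingTriangle (hP : P.Irreducible) (T : Set P.Vertex) :
    ¬ P.IsMissingTriangle T := by
  rintro ⟨h3, hpair, hT⟩
  obtain ⟨t, rfl⟩ := exists_fin_three_range h3
  refine hP (exists_isConnectedSum_of_missing_triangle (injective_of_ncard_range h3)
    (fun k => (hpair (t (k + 1)) ⟨_, rfl⟩ (t (k + 2)) ⟨_, rfl⟩).mono ?_) hT)
  rintro _ ⟨⟨l, rfl⟩, hl⟩
  have h1 : ∀ k l : Fin 3, l = k ∨ l = k + 1 ∨ l = k + 2 := by decide
  rcases h1 k l with rfl | rfl | rfl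
  · exact (hl rfl).elim
  · exact Or.inl rfl
  · exact Or.inr rfl

namespace IsSumAlong

variable {a : Fin 3 → P.Vertex} {b : Fin 3 → Q.Vertex} {i : P.Vertex ↪ R.Vertex}
  {j : Q.Vertex ↪ R.Vertex}

theorem symm (h : IsSumAlong a b i j) : IsSumAlong b a j i where
  facet_left := h.facet_right
  facet_right := h.facet_left
  comm k := (h.comm k).symm
  inter := by
    rw [Set.inter_comm, ← image_range_eq h.comm]
    exact h.inter
  union := by rw [Set.union_comm, h.union]
  isFace_iff τ := (h.isFace_iff τ).trans or_comm

theorem isFace_image (h : IsSumAlong a b i j) {σ : Set P.Vertex} (hσ : P.IsFace σ)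
    (hne : σ ≠ Set.range a) : R.IsFace (i '' σ) :=
  (h.isFace_iff _).2 (Or.inl ⟨σ, hσ, hne, rfl⟩)

theorem pair_ne (h : IsSumAlong a b i j) (u v : P.Vertex) : {u, v} ≠ Set.range a := fun h' => by
  have := h.facet_left.2
  rw [← h'] at this
  have := Set.ncard_insert_le u {v}
  rw [Set.ncard_singleton] at this
  omega

/-- Gluing creates no new edge inside `P`: an edge coming from `Q` with both ends in `P` lies in the
common triangle, whose edges `P` already has. -/
theorem isFace_pair_iff (h : IsSumAlong a b i j) (u v : P.Vertex) :
    R.IsFace {i u, i v} ↔ P.IsFace {u, v} := by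
  rw [← Set.image_pair]
  refine ⟨fun hf => ?_, fun hf => h.isFace_image hf (h.pair_ne u v)⟩
  rcases (h.isFace_iff _).1 hf with ⟨σ, hσ, -, hσ'⟩ | ⟨σ, -, -, hσ'⟩
  · rwa [← i.injective.image_injective hσ']
  · refine h.facet_left.1.mono ?_
    rw [← Set.image_subset_image_iff i.injective]
    refine (Set.subset_inter (Set.image_subset_range _ _) ?_).trans h.inter
    rw [← hσ']
    exact Set.image_subset_range _ _

theorem subset_range_of_isFace (h : IsSumAlong a b i j) {τ : Set R.Vertex} (hτ : R.IsFace τ) :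
    τ ⊆ Set.range i ∨ τ ⊆ Set.range j := by
  rcases (h.isFace_iff _).1 hτ with ⟨σ, -, -, rfl⟩ | ⟨σ, -, -, rfl⟩
  · exact Or.inl (Set.image_subset_range _ _)
  · exact Or.inr (Set.image_subset_range _ _)

theorem isMissingTriangle (h : IsSumAlong a b i j) : R.IsMissingTriangle (i '' Set.range a) := by
  refine ⟨by rw [Set.ncard_image_of_injective _ i.injective, h.facet_left.2], ?_, fun hf => ?_⟩
  · rintro _ ⟨u, hu, rfl⟩ _ ⟨v, hv, rfl⟩
    exact (h.isFace_pair_iff u v).2 (h.facet_left.1.mono (Set.pair_subset hu hv))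
  · rcases (h.isFace_iff _).1 hf with ⟨σ, -, hne, hσ⟩ | ⟨σ, -, hne, hσ⟩
    · exact hne (i.injective.image_injective hσ)
    · rw [image_range_eq h.comm] at hσ
      exact hne (j.injective.image_injective hσ)

/-- The three edges already lie in `P`, so by irreducibility they bound a facet of `P`; only the
deleted one fails to be a face of `R`. -/
theorem eq_of_isMissingTriangle_of_subset (h : IsSumAlong a b i j) (hP : P.Irreducible)
    {T : Set R.Vertex} (hT : R.IsMissingTriangle T) (hsub : T ⊆ Set.range i) :
    T = i '' Set.range a := by
  obtain ⟨σ, rfl⟩ := Set.subset_range_iff_exists_image_eq.1 hsub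
  obtain ⟨h3, hpair, hnf⟩ := hT
  rw [Set.ncard_image_of_injective _ i.injective] at h3
  have hσ : P.IsFace σ := by
    by_contra hσ
    exact hP.not_isMissingTriangle σ ⟨h3, fun u hu v hv =>
      (h.isFace_pair_iff u v).1 (hpair _ ⟨u, hu, rfl⟩ _ ⟨v, hv, rfl⟩), hσ⟩
  by_contra hne
  exact hnf (h.isFace_image hσ fun h' => hne (by rw [h']))

/-- The common triangle is the only missing triangle of a connected sum of irreducible polytopes. -/
theorem eq_of_isMissingTriangle (h : IsSumAlong a b i j) (hP : P.Irreducible) (hQ : Q.Irreducible)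
    {T : Set R.Vertex} (hT : R.IsMissingTriangle T) : T = i '' Set.range a := by
  by_cases hi : T ⊆ Set.range i
  · exact h.eq_of_isMissingTriangle_of_subset hP hT hi
  by_cases hj : T ⊆ Set.range j
  · rw [image_range_eq h.comm]
    exact h.symm.eq_of_isMissingTriangle_of_subset hQ hT hj
  -- A triangle contained in neither side would have an edge between the two sides, outside the
  -- common triangle.
  obtain ⟨x, hx, hxi⟩ := Set.not_subset.1 hi
  obtain ⟨y, hy, hyj⟩ := Set.not_subset.1 hj
  rcases h.subset_range_of_isFace (hT.2.1 x hx y hy) with hs | hs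
  · exact (hxi (hs (Or.inl rfl))).elim
  · exact (hyj (hs (Or.inr rfl))).elim

theorem neighborSet_eq (h : IsSumAlong a b i j) (k : Fin 3) :
    R.graph.neighborSet (i (a k)) =
      i '' P.graph.neighborSet (a k) ∪ j '' Q.graph.neighborSet (b k) := by
  ext x
  constructor
  · rintro ⟨hne, hf⟩
    rcases h.subset_range_of_isFace hf with hs | hs
    · obtain ⟨v, rfl⟩ := hs (Or.inr rfl)
      exact Or.inl ⟨v, ⟨fun h' => hne (h' ▸ rfl), (h.isFace_pair_iff _ _).1 hf⟩, rfl⟩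
    · obtain ⟨v, rfl⟩ := hs (Or.inr rfl)
      rw [h.comm] at hne hf
      exact Or.inr ⟨v, ⟨fun h' => hne (h' ▸ rfl), (h.symm.isFace_pair_iff _ _).1 hf⟩, rfl⟩
  · rintro (⟨v, ⟨hne, hf⟩, rfl⟩ | ⟨v, ⟨hne, hf⟩, rfl⟩)
    · exact ⟨fun h' => hne (i.injective h'), (h.isFace_pair_iff _ _).2 hf⟩
    · rw [h.comm]
      exact ⟨fun h' => hne (j.injective h'), (h.symm.isFace_pair_iff _ _).2 hf⟩

theorem diff_subset_neighborSet (h : IsSumAlong a b i j) (k : Fin 3) :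
    i '' (Set.range a \ {a k}) ⊆ i '' P.graph.neighborSet (a k) := by
  refine Set.image_mono ?_
  rintro v ⟨hv, hne⟩
  exact ⟨fun h' => hne h'.symm, h.facet_left.1.mono (Set.pair_subset ⟨k, rfl⟩ hv)⟩

/-- The neighbours from the two sides overlap exactly in the other two vertices of the common
triangle. -/
theorem degree_add_two (h : IsSumAlong a b i j) (k : Fin 3) :
    R.degree (i (a k)) + 2 = P.degree (a k) + Q.degree (b k) := by
  have hinter : i '' P.graph.neighborSet (a k) ∩ j '' Q.graph.neighborSet (b k) =
      i '' (Set.range a \ {a k}) := by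
    refine subset_antisymm ?_ (Set.subset_inter (h.diff_subset_neighborSet k) ?_)
    · rintro x ⟨⟨v, hv, rfl⟩, ⟨w, -, hw⟩⟩
      obtain ⟨u, hu, huv⟩ := h.inter ⟨⟨v, rfl⟩, ⟨w, hw⟩⟩
      rw [i.injective huv] at hu
      exact ⟨v, ⟨hu, fun h' => hv.1 h'.symm⟩, rfl⟩
    · rw [Set.image_sdiff i.injective, image_range_eq h.comm, Set.image_singleton, h.comm,
        ← Set.image_singleton, ← Set.image_sdiff j.injective]
      exact h.symm.diff_subset_neighborSet k
  have h2 : (i '' (Set.range a \ {a k})).ncard = 2 := by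
    rw [Set.ncard_image_of_injective _ i.injective, Set.ncard_sdiff_singleton_of_mem (Set.mem_range_self k),
      h.facet_left.2]
  have h3 := Set.ncard_union_add_ncard_inter (i '' P.graph.neighborSet (a k))
    (j '' Q.graph.neighborSet (b k))
  rw [hinter, h2, ← h.neighborSet_eq, Set.ncard_image_of_injective _ i.injective,
    Set.ncard_image_of_injective _ j.injective] at h3
  exact h3

end IsSumAlong

theorem isMissingTriangle_image {S : SimplicialPolytope} (e : R.Vertex ≃ S.Vertex)
    (he : ∀ σ, R.IsFace σ ↔ S.IsFace (e '' σ)) {T : Set R.Vertex} (hT : R.IsMissingTriangle T) :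
    S.IsMissingTriangle (e '' T) := by
  refine ⟨by rw [Set.ncard_image_of_injective _ e.injective, hT.1], ?_,
    fun h => hT.2.2 ((he T).2 h)⟩
  rintro _ ⟨u, hu, rfl⟩ _ ⟨v, hv, rfl⟩
  rw [← Set.image_pair, ← he]
  exact hT.2.1 u hu v hv

theorem degree_apply_equiv {S : SimplicialPolytope} (e : R.Vertex ≃ S.Vertex)
    (he : ∀ σ, R.IsFace σ ↔ S.IsFace (e '' σ)) (v : R.Vertex) : S.degree (e v) = R.degree v := by
  have : S.graph.neighborSet (e v) = e '' R.graph.neighborSet v := by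
    ext x
    obtain ⟨w, rfl⟩ := e.surjective x
    rw [e.injective.mem_set_image]
    change (e v ≠ e w ∧ S.IsFace {e v, e w}) ↔ (v ≠ w ∧ R.IsFace {v, w})
    rw [e.injective.ne_iff, he, Set.image_pair]
  rw [degree, this, Set.ncard_image_of_injective _ e.injective, degree]

/-- The two gluings are isomorphic, and the isomorphism carries the unique missing triangle of one
to that of the other while preserving degrees. -/
theorem exists_perm_degree_add_eq (hP : P.Irreducible) (hQ : Q.Irreducible)
    (h : (connectedSums P Q).ncard = 1) {a a' : Fin 3 → P.Vertex} {b b' : Fin 3 → Q.Vertex}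
    (ha : P.IsFacet (Set.range a)) (ha' : P.IsFacet (Set.range a'))
    (hb : Q.IsFacet (Set.range b)) (hb' : Q.IsFacet (Set.range b')) :
    ∃ π : Equiv.Perm (Fin 3), ∀ k,
      P.degree (a k) + Q.degree (b k) = P.degree (a' (π k)) + Q.degree (b' (π k)) := by
  obtain ⟨R, i, j, hR⟩ := exists_isSumAlong ha hb
  obtain ⟨S, i', j', hS⟩ := exists_isSumAlong ha' hb'
  obtain ⟨c, hc⟩ := Set.ncard_eq_one.1 h
  have hRc : Quotient.mk isoSetoid R ∈ connectedSums P Q :=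
    ⟨R, isConnectedSum_iff.2 ⟨_, _, _, _, hR⟩, rfl⟩
  have hSc : Quotient.mk isoSetoid S ∈ connectedSums P Q :=
    ⟨S, isConnectedSum_iff.2 ⟨_, _, _, _, hS⟩, rfl⟩
  rw [hc, Set.mem_singleton_iff] at hRc hSc
  obtain ⟨e, he⟩ : Isomorphic R S := Quotient.exact (hRc.trans hSc.symm)
  have hT := hS.eq_of_isMissingTriangle hP hQ (isMissingTriangle_image e he hR.isMissingTriangle)
  have hex : ∀ k, ∃ l, i' (a' l) = e (i (a k)) := fun k => by
    obtain ⟨_, ⟨l, rfl⟩, hl⟩ := hT.le ⟨_, ⟨_, ⟨k, rfl⟩, rfl⟩, rfl⟩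
    exact ⟨l, hl⟩
  choose π hπ using hex
  have hinj : Function.Injective π := fun k l hkl => by
    apply injective_of_ncard_range ha.2
    apply i.injective
    apply e.injective
    rw [← hπ, ← hπ, hkl]
  refine ⟨Equiv.ofBijective π (Finite.injective_iff_bijective.1 hinj), fun k => ?_⟩
  rw [Equiv.ofBijective_apply, ← hR.degree_add_two, ← hS.degree_add_two, hπ,
    degree_apply_equiv e he]

/-! ### Arithmetic of the degree triples and conclusion. -/

/-- Comparing sums of squares shows that `∑ k, p k * q (σ k)` does not depend on `σ`. Exchanging two
values of `q` then gives a vanishing product of a difference of `p` and a difference of `q`. -/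
theorem forall_eq_or_forall_eq_of_perm {p q : Fin 3 → ℕ}
    (h : ∀ σ : Equiv.Perm (Fin 3), ∃ π : Equiv.Perm (Fin 3), ∀ k,
      p k + q (σ k) = p (π k) + q (π k)) : (∀ k l, p k = p l) ∨ ∀ k l, q k = q l := by
  have h1 : ∀ σ : Equiv.Perm (Fin 3), ∑ k, p k * q (σ k) = ∑ k, p k * q k := by
    intro σ
    obtain ⟨π, hπ⟩ := h σ
    have h2 : ∑ k, (p k + q (σ k)) ^ 2 = ∑ k, (p k + q k) ^ 2 := by
      rw [← Equiv.sum_comp π fun k => (p k + q k) ^ 2]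
      exact Finset.sum_congr rfl fun k _ => by rw [hπ]
    have h3 : ∑ k, q (σ k) ^ 2 = ∑ k, q k ^ 2 := Equiv.sum_comp σ fun k => q k ^ 2
    simp only [add_sq, Finset.sum_add_distrib, mul_assoc, ← Finset.mul_sum] at h2
    omega
  -- Permuting `p` and `q` independently brings any unequal pair of each to the positions 0 and 1.
  have h2 : ∀ ρ τ : Equiv.Perm (Fin 3), ∑ k, p (ρ k) * q (τ k) = ∑ k, p k * q k := by
    intro ρ τ
    rw [← h1 (ρ.symm.trans τ), ← Equiv.sum_comp ρ fun k => p k * q ((ρ.symm.trans τ) k)]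
    simp
  have hperm : ∀ k l : Fin 3, k ≠ l → ∃ ρ : Equiv.Perm (Fin 3), ρ 0 = k ∧ ρ 1 = l := by decide
  by_contra! hne
  obtain ⟨⟨k, l, hkl⟩, m, n, hmn⟩ := hne
  obtain ⟨ρ, rfl, rfl⟩ := hperm k l fun h => hkl (h ▸ rfl)
  obtain ⟨τ, rfl, rfl⟩ := hperm m n fun h => hmn (h ▸ rfl)
  have h3 := (h2 ρ τ).trans (h2 ρ ((Equiv.swap 0 1).trans τ)).symm
  have h4 : Equiv.swap (0 : Fin 3) 1 2 = 2 := by decide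
  simp only [Fin.sum_univ_three, Equiv.trans_apply, Equiv.swap_apply_left,
    Equiv.swap_apply_right, h4] at h3
  zify at h3 hkl hmn
  have h5 : ((p (ρ 0) : ℤ) - p (ρ 1)) * (q (τ 0) - q (τ 1)) = 0 := by linear_combination h3
  rcases mul_eq_zero.1 h5 with h | h
  · exact hkl (sub_eq_zero.1 h)
  · exact hmn (sub_eq_zero.1 h)

theorem facetHasType_range {a : Fin 3 → P.Vertex} (ha : Function.Injective a)
    (h01 : P.degree (a 0) ≥ P.degree (a 1)) (h12 : P.degree (a 1) ≥ P.degree (a 2)) :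
    P.FacetHasType (Set.range a) (P.degree (a 0)) (P.degree (a 1)) (P.degree (a 2)) := by
  refine ⟨h01, h12, a 0, a 1, a 2, ha.ne (by decide), ha.ne (by decide), ha.ne (by decide), ?_,
    rfl, rfl, rfl⟩
  ext v
  simp [Fin.exists_fin_succ, eq_comm]

theorem exists_perm_antitone (f : Fin 3 → ℕ) :
    ∃ σ : Equiv.Perm (Fin 3), f (σ 0) ≥ f (σ 1) ∧ f (σ 1) ≥ f (σ 2) := by
  have h := Tuple.monotone_sort f
  exact ⟨Fin.revPerm.trans (Tuple.sort f), h (by decide), h (by decide)⟩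

/-- With the facet of `Q` fixed, total degree sums determine the common degree on each facet of `P`.
With the facet of `P` fixed, its constant degree cancels and the degrees on facets of `Q` agree up
to order. -/
theorem regular_and_faceTransitive {a₀ : Fin 3 → P.Vertex} {b₀ : Fin 3 → Q.Vertex}
    (ha₀ : P.IsFacet (Set.range a₀)) (hb₀ : Q.IsFacet (Set.range b₀))
    (hconst : ∀ a : Fin 3 → P.Vertex, P.IsFacet (Set.range a) → ∀ k l,
      P.degree (a k) = P.degree (a l))
    (hsum : ∀ (a a' : Fin 3 → P.Vertex) (b b' : Fin 3 → Q.Vertex), P.IsFacet (Set.range a) →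
      P.IsFacet (Set.range a') → Q.IsFacet (Set.range b) → Q.IsFacet (Set.range b') →
      ∃ π : Equiv.Perm (Fin 3), ∀ k,
        P.degree (a k) + Q.degree (b k) = P.degree (a' (π k)) + Q.degree (b' (π k))) :
    P.Regular ∧ Q.FaceTransitive := by
  constructor
  · refine ⟨P.degree (a₀ 0), fun F hF => ?_⟩
    obtain ⟨a, rfl⟩ := exists_fin_three_range hF.2
    have hc := hconst a hF
    obtain ⟨π, hπ⟩ := hsum a a₀ b₀ b₀ hF ha₀ hb₀ hb₀
    have h1 : ∑ k, (P.degree (a k) + Q.degree (b₀ k)) =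
        ∑ k, (P.degree (a₀ k) + Q.degree (b₀ k)) := by
      rw [← Equiv.sum_comp π fun k => P.degree (a₀ k) + Q.degree (b₀ k)]
      exact Finset.sum_congr rfl fun k _ => hπ k
    simp only [Finset.sum_add_distrib, add_left_inj, hc _ 0, hconst a₀ ha₀ _ 0, Finset.sum_const,
      Finset.card_univ, Fintype.card_fin, smul_eq_mul] at h1
    have h2 := facetHasType_range (injective_of_ncard_range hF.2) (hc 0 1).ge (hc 1 2).ge
    rw [hc 1 0, hc 2 0] at h2
    rwa [show P.degree (a₀ 0) = P.degree (a 0) by omega]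
  · obtain ⟨σ, h01, h12⟩ := exists_perm_antitone fun k => Q.degree (b₀ k)
    have hb₁ : Q.IsFacet (Set.range (b₀ ∘ σ)) := by rwa [σ.surjective.range_comp]
    refine ⟨Q.degree (b₀ (σ 0)), Q.degree (b₀ (σ 1)), Q.degree (b₀ (σ 2)), fun G hG => ?_⟩
    obtain ⟨b, rfl⟩ := exists_fin_three_range hG.2
    obtain ⟨π, hπ⟩ := hsum a₀ a₀ (b₀ ∘ σ) b ha₀ ha₀ hb₁ hG
    have h1 : ∀ k, Q.degree (b₀ (σ k)) = Q.degree ((b ∘ π) k) := fun k =>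
      Nat.add_left_cancel ((hπ k).trans (by rw [hconst a₀ ha₀ (π k) k]; rfl))
    rw [← π.surjective.range_comp b, h1, h1, h1]
    refine facetHasType_range ((injective_of_ncard_range hG.2).comp π.injective) ?_ ?_
    · rw [← h1, ← h1]; exact h01
    · rw [← h1, ← h1]; exact h12

end SimplicialPolytope

theorem mainTheorem8 (P Q : SimplicialPolytope) (hP : P.Irreducible) (hQ : Q.Irreducible)
    (h : (SimplicialPolytope.connectedSums P Q).ncard = 1) :
    (P.Regular ∧ Q.FaceTransitive) ∨ (Q.Regular ∧ P.FaceTransitive) := by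
  have hsum := fun a a' b b' ha ha' hb hb' =>
    SimplicialPolytope.exists_perm_degree_add_eq hP hQ h (a := a) (a' := a') (b := b) (b' := b')
      ha ha' hb hb'
  obtain ⟨c, hc⟩ := Set.ncard_eq_one.1 h
  obtain ⟨R, hR, -⟩ := hc.ge rfl
  obtain ⟨a₀, b₀, i, j, hR⟩ := SimplicialPolytope.isConnectedSum_iff.1 hR
  by_cases hconst : ∀ a : Fin 3 → P.Vertex, P.IsFacet (Set.range a) → ∀ k l,
      P.degree (a k) = P.degree (a l)
  · exact Or.inl (SimplicialPolytope.regular_and_faceTransitive hR.facet_left hR.facet_right hconst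
      hsum)
  -- One facet of `P` with unequal degrees, compared with an arbitrary facet of `Q`, forces the
  -- latter to have constant degrees; the roles are then exchanged.
  · push Not at hconst
    obtain ⟨a, ha, k, l, hkl⟩ := hconst
    refine Or.inr (SimplicialPolytope.regular_and_faceTransitive hR.facet_right hR.facet_left
      (fun b hb => ?_) fun b b' a a' hb hb' ha ha' => ?_)
    · refine (SimplicialPolytope.forall_eq_or_forall_eq_of_perm (p := fun k => P.degree (a k))
        (q := fun k => Q.degree (b k)) fun σ => ?_).resolve_left fun h' => hkl (h' k l)
      exact hsum a a (b ∘ σ) b ha ha (by rwa [σ.surjective.range_comp]) hb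
    · obtain ⟨π, hπ⟩ := hsum a a' b b' ha ha' hb hb'
      exact ⟨π, fun k => by rw [add_comm, hπ, add_comm]⟩
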